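/- \textbf{Setting.} For $\kappa\ge 1$ let $D_\kappa=[-1,-1/\kappa]\cup[1/\kappa,1]$. Let $H\in\mathbb C^{N\times N}$ be Hermitian with all nonzero eigenvalues in $D_\kappa$, and let $H^{-1}=\sum_{\lambda_j\neq0}\lambda_j^{-1}|v_j\rangle\langle v_j|$ (the inverse if $H$ is invertible, the pseudo-inverse in general). Let $|b\rangle$ be a unit vector in the range of $H$ (any unit vector if $H$ is invertible), $|x\rangle=H^{-1}|b\rangle/\|H^{-1}|b\rangle\|$, and let $O$ be a Hermitian matrix with spectral norm $\|O\|$. For $J,K\in\mathbb N$ and $\Delta_y,\Delta_z>0$ put $y_j=j\Delta_y$, $z_k=k\Delta_z$, $$g(x)=\frac{i}{\sqrt{2\pi}}\sum_{j=0}^{J-1}\Delta_y\sum_{k=-K}^{K}\Delta_z z_k e^{-z_k^2/2}e^{-ixy_jz_k}.$$ Then $g(H)=\sum_{j,k}c_{jk}U_{jk}$ with $c_{jk}=\frac1{\sqrt{2\pi}}\Delta_y\Delta_z|z_k|e^{-z_k^2/2}$ and unitaries $U_{jk}=\pm i\,e^{-iy_jz_kH}$ (sign $+$ if $z_k\ge0$,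 $-$ otherwise); $\|c\|_1=\sum c_{jk}$. We say that $(J,K,\Delta_y,\Delta_z)$ has \emph{the standard orders} for $(\kappa,\gamma)$ with constant $A\ge1$ if each of $J,K,\Delta_y,\Delta_z$ lies between $A^{-1}$ and $A$ times, respectively, $\frac\kappa\gamma\log\frac\kappa\gamma$, $\kappa\log\frac\kappa\gamma$, $\gamma/\sqrt{\log(\kappa/\gamma)}$, $1/(\kappa\sqrt{\log(\kappa/\gamma)})$. \textbf{Algorithm.} One run of the circuit (one ancilla qubit): sample $V_1,V_2$ independently from $\{U_{jk},c_{jk}/\|c\|_1\}$, prepare $|+\rangle\langle+|\otimes|b\rangle\langle b|$, apply $|0\rangle\langle0|\otimes I+|1\rangle\langle1|\otimes V_1$ and then $|0\rangle\langle0|\otimes V_2+|1\rangle\langle1|\otimes I$, and measure $X\otimes O$. The algorithm performs $T$ independent runs, with outcomes $\mu_1,\dots,\mu_T$, and sets $\mu=\frac{\|c\|_1^2}{T}\sum_j\mu_j$; it obtains $\tilde\ell$ independently in the same way with $O$ replaced by $I$ ($2T$ runs in total), and outputs $\mu/\tilde\ell$. \textbf{Theorem.} (1) There is a constant $A\ge1$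 such that for all $\kappa\ge1$ and $0<\gamma\le\frac12$ there are parameters having the standard orders for $(\kappa,\gamma)$ with constant $A$ for which $|1/x-g(x)|\le\gamma$ on $D_\kappa$, and $\|H^{-1}-g(H)\|\le\gamma$ for every $N$ and every $H$ as above. (2) For every $A\ge1$ there is a constant $C>0$, depending only on $A$, such that the following holds for all $N$, $\kappa\ge 1$, and all $H$, $|b\rangle$, $O$ as above, and all $\varepsilon,\delta\in(0,1)$ with $\varepsilon\le\|O\|$. Let $\gamma=\varepsilon/(18\|O\|)$, and let $(J,K,\Delta_y,\Delta_z)$ have the standard orders for $(\kappa,\gamma)$ with constant $A$ and satisfy $\|H^{-1}-g(H)\|\le\gamma$. Then for every integer $$T\ \ge\ C\,\frac{\|O\|^2\kappa^4\log^2\!\big(2\|O\|\kappa/\varepsilon\big)\ln(2/\delta)}{\varepsilon^2}$$ the algorithm yields, with probability at least $(1-\delta)^2$, numbers $\mu$ and $\tilde\ell>0$ with $$\Big|\frac{\mu}{\tilde\ell}-\langle x|O|x\rangle\Big|\le\varepsilon .$$ Hence $O\big(\|O\|^2\kappa^4\log^2(2\|O\|\kappa/\varepsilon)\ln(2/\delta)/\varepsilon^2\big)$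 runs suffice. Moreover the total time for which $H$ is evolved in any single run of the circuit (the sum of $|y_jz_k|$ over the two sampled unitaries) is at most $C\,\kappa\log(2\|O\|\kappa/\varepsilon)$. -/

import Mathlib

open scoped Matrix Kronecker Matrix.Norms.L2Operator

noncomputable section

namespace SingleAncilla

/-! ### Measurement of an observable -/

/-- Law of the outcome when the observable `A` is measured on the state `ρ` (Born rule): for an
orthonormal eigenbasis `v i` of `A`, the eigenvalue of `v i` is observed with weight
`⟨v i, ρ (v i)⟩`. Equal eigenvalues add up, so the law does not depend on the eigenbasis. -/
def measureLaw {m : Type*} [Fintype m] [DecidableEq m] {A : Matrix m m ℂ} (hA : A.IsHermitian)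
    (ρ : Matrix m m ℂ) : MeasureTheory.Measure ℝ :=
  ∑ i : m, ENNReal.ofReal
      (star (hA.eigenvectorBasis i).ofLp ⬝ᵥ (ρ *ᵥ (hA.eigenvectorBasis i).ofLp)).re •
    MeasureTheory.Measure.dirac (hA.eigenvalues i)

/-! ### The circuit with one ancilla qubit (the factor `Fin 2`) -/

/-- `|+⟩⟨+|` -/
def plusState : Matrix (Fin 2) (Fin 2) ℂ := !![1 / 2, 1 / 2; 1 / 2, 1 / 2]

/-- `|0⟩⟨0|` -/
def proj0 : Matrix (Fin 2) (Fin 2) ℂ := !![1, 0; 0, 0]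

/-- `|1⟩⟨1|` -/
def proj1 : Matrix (Fin 2) (Fin 2) ℂ := !![0, 0; 0, 1]

/-- The Pauli matrix `X`. -/
def pauliX : Matrix (Fin 2) (Fin 2) ℂ := !![0, 1; 1, 0]

section Circuit

variable {N : ℕ}

/-- `|0⟩⟨0| ⊗ I + |1⟩⟨1| ⊗ V` -/
def controlled (V : Matrix (Fin N) (Fin N) ℂ) : Matrix (Fin 2 × Fin N) (Fin 2 × Fin N) ℂ :=
  proj0 ⊗ₖ (1 : Matrix (Fin N) (Fin N) ℂ) + proj1 ⊗ₖ V

/-- `|0⟩⟨0| ⊗ V + |1⟩⟨1| ⊗ I` -/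
def antiControlled (V : Matrix (Fin N) (Fin N) ℂ) : Matrix (Fin 2 × Fin N) (Fin 2 × Fin N) ℂ :=
  proj0 ⊗ₖ V + proj1 ⊗ₖ (1 : Matrix (Fin N) (Fin N) ℂ)

/-- The state at the end of the circuit, before the measurement. -/
def circuitState (V₁ V₂ ρ₀ : Matrix (Fin N) (Fin N) ℂ) :
    Matrix (Fin 2 × Fin N) (Fin 2 × Fin N) ℂ :=
  antiControlled V₂ * controlled V₁ * (plusState ⊗ₖ ρ₀) *
    (controlled V₁)ᴴ * (antiControlled V₂)ᴴ

theorem isHermitian_pauliX_kronecker {O : Matrix (Fin N) (Fin N) ℂ} (hO : O.IsHermitian) :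
    (pauliX ⊗ₖ O).IsHermitian := by
  have hX : pauliXᴴ = pauliX := by
    ext i j; fin_cases i <;> fin_cases j <;> simp [pauliX]
  rw [Matrix.IsHermitian, Matrix.conjTranspose_kronecker, hX, hO.eq]

/-! ### The algorithms -/

variable {ι : Type*} [Fintype ι]

/-- Law of the outcome of one run of the circuit: `p`, `q` are sampled independently with
probabilities `c p / ‖c‖₁`, `c q / ‖c‖₁`, the circuit is run with `V₁ = U p` and `V₂ = U q`, and
`X ⊗ O` is measured. -/
def runLaw {O : Matrix (Fin N) (Fin N) ℂ} (hO : O.IsHermitian) (c : ι → ℝ)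
    (U : ι → Matrix (Fin N) (Fin N) ℂ) (ρ₀ : Matrix (Fin N) (Fin N) ℂ) :
    MeasureTheory.Measure ℝ :=
  ∑ p : ι, ∑ q : ι, ENNReal.ofReal ((c p / ∑ r, c r) * (c q / ∑ r, c r)) •
    measureLaw (isHermitian_pauliX_kronecker hO) (circuitState (U p) (U q) ρ₀)

/-- Law of the output `(‖c‖₁² / T) ∑ μ_j` of `Expectation-observable (O, {c_j, U_j}, ρ₀, T)`, where
`μ_1, …, μ_T` are the outcomes of `T` independent runs of the circuit. -/
def expectationObservable {O : Matrix (Fin N) (Fin N) ℂ} (hO : O.IsHermitian) (c : ι → ℝ)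
    (U : ι → Matrix (Fin N) (Fin N) ℂ) (ρ₀ : Matrix (Fin N) (Fin N) ℂ) (T : ℕ) :
    MeasureTheory.Measure ℝ :=
  (MeasureTheory.Measure.pi fun _ : Fin T => runLaw hO c U ρ₀).map
    fun ω => (∑ r, c r) ^ 2 / (T : ℝ) * ∑ j, ω j

/-- Joint law of the pair `(μ, ℓ)` produced by `Single-ancilla-LCU (O, {c_j, U_j}, ρ₀)`: one call of
`Expectation-observable` with the observable `O` and an independent one with the identity, each with
`T` runs of the circuit (`2 * T` runs in total). -/
def singleAncillaLCU {O : Matrix (Fin N) (Fin N) ℂ} (hO : O.IsHermitian) (c : ι → ℝ)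
    (U : ι → Matrix (Fin N) (Fin N) ℂ) (ρ₀ : Matrix (Fin N) (Fin N) ℂ) (T : ℕ) :
    MeasureTheory.Measure (ℝ × ℝ) :=
  (expectationObservable hO c U ρ₀ T).prod
    (expectationObservable
      (Matrix.isHermitian_one : (1 : Matrix (Fin N) (Fin N) ℂ).IsHermitian) c U ρ₀ T)

/-- The density matrix `|b⟩⟨b|`. -/
def pureState (b : EuclideanSpace ℂ (Fin N)) : Matrix (Fin N) (Fin N) ℂ :=
  Matrix.vecMulVec b.ofLp (star b.ofLp)

/-- `⟨x|O|x⟩` -/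
def expectation (O : Matrix (Fin N) (Fin N) ℂ) (x : EuclideanSpace ℂ (Fin N)) : ℝ :=
  (inner ℂ x (Matrix.toEuclideanCLM (n := Fin N) (𝕜 := ℂ) O x)).re

/-! ### The linear system -/

/-- `[-1, -1/κ] ∪ [1/κ, 1]` -/
def invDomain (κ : ℝ) : Set ℝ := Set.Icc (-1) (-(1 / κ)) ∪ Set.Icc (1 / κ) 1

/-- `H⁻¹ = ∑ λ_j⁻¹ |v_j⟩⟨v_j|`, the sum over the nonzero eigenvalues (`0⁻¹ = 0`): the inverse if `H`
is invertible, and its pseudo-inverse in general. -/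
def hermInv {H : Matrix (Fin N) (Fin N) ℂ} (hH : H.IsHermitian) : Matrix (Fin N) (Fin N) ℂ :=
  hH.cfc fun x : ℝ => x⁻¹

theorem hermInv_eq_inv {H : Matrix (Fin N) (Fin N) ℂ} (hH : H.IsHermitian) (h : IsUnit H) :
    hermInv hH = H⁻¹ := by
  have hdet : IsUnit H.det := (Matrix.isUnit_iff_isUnit_det H).1 h
  have hne : ∀ i, hH.eigenvalues i ≠ 0 := by
    intro i hi
    rw [hH.det_eq_prod_eigenvalues] at hdet
    exact hdet.ne_zero (Finset.prod_eq_zero (Finset.mem_univ i) (by simp [hi]))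
  refine (Matrix.inv_eq_left_inv ?_).symm
  have h0 : hermInv hH * H = hermInv hH * _ := congrArg (hermInv hH * ·) hH.spectral_theorem
  rw [h0, hermInv, Matrix.IsHermitian.cfc, ← map_mul, Matrix.diagonal_mul_diagonal]
  have h1 : (Matrix.diagonal fun i => ((RCLike.ofReal ∘ (fun x : ℝ => x⁻¹) ∘ hH.eigenvalues) i : ℂ) *
      (RCLike.ofReal ∘ hH.eigenvalues) i) = (1 : Matrix (Fin N) (Fin N) ℂ) := by
    rw [← Matrix.diagonal_one]
    congr 1
    funext i
    simp [hne i]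
  rw [h1, map_one]

/-- `|x⟩ = H⁻¹|b⟩ / ‖H⁻¹|b⟩‖` -/
def solutionState {H : Matrix (Fin N) (Fin N) ℂ} (hH : H.IsHermitian)
    (b : EuclideanSpace ℂ (Fin N)) : EuclideanSpace ℂ (Fin N) :=
  ((‖Matrix.toEuclideanCLM (n := Fin N) (𝕜 := ℂ) (hermInv hH) b‖⁻¹ : ℝ) : ℂ) •
    Matrix.toEuclideanCLM (n := Fin N) (𝕜 := ℂ) (hermInv hH) b

end Circuit

/-! ### The Fourier decomposition of the inverse -/

/-- The discretization parameters: `y_j = j Δy` for `0 ≤ j < J` and `z_k = k Δz` for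
`-K ≤ k ≤ K`. -/
structure FourierParams where
  J : ℕ
  K : ℕ
  Δy : ℝ
  Δz : ℝ

namespace FourierParams

variable (P : FourierParams)

/-- `J = Θ((κ/γ) log(κ/γ))`, `K = Θ(κ log(κ/γ))`, `Δy = Θ(γ / √(log(κ/γ)))` and
`Δz = Θ(1 / (κ √(log(κ/γ))))`, with the constant `A` in all bounds. -/
structure IsTheta (A κ γ : ℝ) : Prop where
  J_lower : A⁻¹ * (κ / γ * Real.log (κ / γ)) ≤ P.J
  J_upper : (P.J : ℝ) ≤ A * (κ / γ * Real.log (κ / γ))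
  K_lower : A⁻¹ * (κ * Real.log (κ / γ)) ≤ P.K
  K_upper : (P.K : ℝ) ≤ A * (κ * Real.log (κ / γ))
  Δy_lower : A⁻¹ * (γ / √(Real.log (κ / γ))) ≤ P.Δy
  Δy_upper : P.Δy ≤ A * (γ / √(Real.log (κ / γ)))
  Δz_lower : A⁻¹ * (κ * √(Real.log (κ / γ)))⁻¹ ≤ P.Δz
  Δz_upper : P.Δz ≤ A * (κ * √(Real.log (κ / γ)))⁻¹

/-- `y_j = j Δy` -/
def y (j : ℕ) : ℝ := j * P.Δy

/-- `z_k = k Δz` -/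
def z (k : ℤ) : ℝ := k * P.Δz

/-- `g(x) = (i/√(2π)) ∑_{j=0}^{J-1} Δy ∑_{k=-K}^{K} Δz z_k exp(-z_k²/2) exp(-i x y_j z_k)` -/
def g (x : ℝ) : ℂ :=
  Complex.I / (√(2 * Real.pi) : ℝ) * ∑ j ∈ Finset.range P.J, (P.Δy : ℂ) *
    ∑ k ∈ Finset.Icc (-(P.K : ℤ)) (P.K : ℤ),
      ((P.Δz * P.z k * Real.exp (-(P.z k) ^ 2 / 2) : ℝ) : ℂ) *
        Complex.exp (-(Complex.I * (x * P.y j * P.z k)))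

/-- The time evolution operator `exp(-i t H)`. -/
def evolution {N : ℕ} (H : Matrix (Fin N) (Fin N) ℂ) (t : ℝ) : Matrix (Fin N) (Fin N) ℂ :=
  NormedSpace.exp (-(Complex.I * t) • H)

/-- `g(H)` -/
def gMat {N : ℕ} (H : Matrix (Fin N) (Fin N) ℂ) : Matrix (Fin N) (Fin N) ℂ :=
  (Complex.I / (√(2 * Real.pi) : ℝ)) • ∑ j ∈ Finset.range P.J, (P.Δy : ℂ) •
    ∑ k ∈ Finset.Icc (-(P.K : ℤ)) (P.K : ℤ),
      ((P.Δz * P.z k * Real.exp (-(P.z k) ^ 2 / 2) : ℝ) : ℂ) • evolution H (P.y j * P.z k)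

/-- The index set of the linear combination of unitaries: pairs `(j, k)`. -/
abbrev Index : Type := Fin P.J × Finset.Icc (-(P.K : ℤ)) (P.K : ℤ)

/-- The LCU coefficients `c_{jk} = Δy Δz |z_k| exp(-z_k²/2) / √(2π)`. -/
def coeff (p : P.Index) : ℝ :=
  P.Δy * P.Δz * |P.z p.2| * Real.exp (-(P.z p.2) ^ 2 / 2) / √(2 * Real.pi)

/-- The evolution time `y_j z_k` of the unitary with index `(j, k)`. -/
def time (p : P.Index) : ℝ := P.y p.1 * P.z p.2

/-- The unitary with index `(j, k)`: `exp(-i y_j z_k H)` times the phase `i` or `-i` of the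
coefficient. -/
def unitary {N : ℕ} (H : Matrix (Fin N) (Fin N) ℂ) (p : P.Index) : Matrix (Fin N) (Fin N) ℂ :=
  (if 0 ≤ P.z p.2 then Complex.I else -Complex.I) • evolution H (P.time p)

/-- `g(H)` is the linear combination of the unitaries with the coefficients `c_{jk}`. -/
theorem sum_coeff_unitary {N : ℕ} (H : Matrix (Fin N) (Fin N) ℂ) :
    ∑ p : P.Index, (P.coeff p : ℂ) • P.unitary H p = P.gMat H := by
  have hk : ∀ k : ℤ, ∀ j : ℕ,
      (((P.Δy * P.Δz * |P.z k| * Real.exp (-(P.z k) ^ 2 / 2) / √(2 * Real.pi) : ℝ) : ℂ) •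
        ((if 0 ≤ P.z k then Complex.I else -Complex.I) • evolution H (P.y j * P.z k))) =
      (Complex.I / (√(2 * Real.pi) : ℝ)) • (P.Δy : ℂ) •
        ((P.Δz * P.z k * Real.exp (-(P.z k) ^ 2 / 2) : ℝ) : ℂ) •
          evolution H (P.y j * P.z k) := by
    intro k j
    simp only [smul_smul]
    congr 1
    split_ifs with h
    · rw [abs_of_nonneg h]
      push_cast
      ring
    · rw [abs_of_neg (not_le.1 h)]
      push_cast
      ring
  rw [gMat, Fintype.sum_prod_type, Finset.smul_sum, ← Fin.sum_univ_eq_sum_range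
    (fun j => (Complex.I / (√(2 * Real.pi) : ℝ)) • (P.Δy : ℂ) •
      ∑ k ∈ Finset.Icc (-(P.K : ℤ)) (P.K : ℤ),
        ((P.Δz * P.z k * Real.exp (-(P.z k) ^ 2 / 2) : ℝ) : ℂ) • evolution H (P.y j * P.z k))]
  refine Finset.sum_congr rfl fun j _ => ?_
  rw [Finset.smul_sum, Finset.smul_sum,
    ← Finset.sum_coe_sort (Finset.Icc (-(P.K : ℤ)) (P.K : ℤ))]
  exact Finset.sum_congr rfl fun k _ => hk k j

/-- The maximal total time for which `H` is evolved in one coherent run of the circuit, which uses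
one unitary for `V₁` and one for `V₂`. -/
def maxRunTime : ℝ := ⨆ pq : P.Index × P.Index, |P.time pq.1| + |P.time pq.2|

end FourierParams

end SingleAncilla

end

namespace SingleAncilla

/-! ### Gaussian sums -/

/-! For nonzero x, 1/x = (i/√(2π)) ∫₀^∞ dy ∫ dz z e^{-z²/2} e^{-ixyz}: with its prefactor the inner
integral is t e^{-t²/2} at t = xy, and ∫₀^∞ xy e^{-(xy)²/2} dy = 1/x. The function `g` discretizes
and truncates both integrals. In z the discretization error is exponentially small, because Poisson
summation turns it into aliases at distance 2π/Δz (`norm_gaussian_fourier_sub_le`). In y it is O(Δy)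
uniformly in x, because t e^{-t²/2} has bounded variation (`abs_riemann_sum_sub_le`). The tail
beyond Y = J Δy costs at most κ e^{-(Y/κ)²/2}. Parameters with Y of order κ√log(κ/γ) and K Δz of
order √log(κ/γ) bring the total below γ. Since H⁻¹, g(H) and the evolutions are simultaneously
diagonal, the scalar bound passes to matrices (`norm_hermInv_sub_gMat_le`).

For the algorithm, the final pure state is (|0⟩V₂b + |1⟩V₁b)/√2, and X ⊗ O sees only its cross
terms, with mean Re⟨V₂b, O V₁b⟩. Averaging over the sampled unitaries and multiplying by ‖c‖₁² gives
exactly ⟨g(H)b, O g(H)b⟩ (`integral_runLaw`). Outcomes lie in [-‖O‖, ‖O‖], so Hoeffding's inequality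
(`abs_map_sum_sub_le_of_mem_Icc`) asks for T of order ‖O‖²‖c‖₁⁴ log(2/δ)/ε² runs. As ‖c‖₁ =
O(κ√log(κ/γ)), this is the stated count. The two estimates are independent, whence (1-δ)².

Since ‖H‖ ≤ 1 on the relevant spectrum, ‖H⁻¹b‖ ≥ 1. The denominator of the ratio is therefore
bounded away from 0, and `ratio_sub_expectation_le` bounds the error of the quotient. -/

theorem hasSum_congr_of_eq {α E : Type*} [AddCommMonoid E] [TopologicalSpace E] {f g : α → E}
    {a : E} (h : ∀ i, f i = g i) : HasSum f a ↔ HasSum g a := by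
  rw [funext h]

/-- The omitted terms are dominated by two geometric tails, one on each side. The lemma serves both
for truncating the sum in z and for discarding the Poisson aliases. -/
theorem norm_sub_sum_Icc_le_of_geometric {f : ℤ → ℂ} {S : ℂ} (hf : HasSum f S) {B q : ℝ}
    (hq0 : 0 ≤ q) (hq1 : q < 1) (K : ℕ)
    (hle : ∀ k : ℤ, K < k.natAbs → ‖f k‖ ≤ B * q ^ k.natAbs) :
    ‖S - ∑ k ∈ Finset.Icc (-(K : ℤ)) K, f k‖ ≤ 2 * (B * q ^ (K + 1) / (1 - q)) := by
  have hgeom : HasSum (fun n : ℕ => if n < K + 1 then 0 else B * q ^ n)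
      (B * q ^ (K + 1) / (1 - q)) := by
    rw [← hasSum_nat_add_iff' (K + 1)]
    have h0 : ∑ i ∈ Finset.range (K + 1), (if i < K + 1 then 0 else B * q ^ i) = 0 :=
      Finset.sum_eq_zero fun i hi => if_pos (Finset.mem_range.1 hi)
    rw [h0, sub_zero, div_eq_mul_inv]
    refine (hasSum_congr_of_eq fun n => ?_).mpr
      ((hasSum_geometric_of_lt_one hq0 hq1).mul_left (B * q ^ (K + 1)))
    rw [if_neg (by omega), pow_add]
    ring
  -- Negative integers are indexed as `-(n + 1)`, so their tail is the same series shifted by one;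
  -- the lost term `n = 0` vanishes.
  have hgeom' : HasSum (fun n : ℕ => if n + 1 < K + 1 then 0 else B * q ^ (n + 1))
      (B * q ^ (K + 1) / (1 - q)) := by
    have := (hasSum_nat_add_iff' 1).2 hgeom
    simpa using this
  have hg : HasSum (fun k : ℤ => if k.natAbs < K + 1 then 0 else B * q ^ k.natAbs)
      (B * q ^ (K + 1) / (1 - q) + B * q ^ (K + 1) / (1 - q)) := by
    refine HasSum.of_nat_of_neg_add_one ?_ ?_
    · simpa using hgeom
    · refine (hasSum_congr_of_eq fun n => ?_).mpr hgeom'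
      have : (-((n : ℤ) + 1)).natAbs = n + 1 := by omega
      simp only [this]
  have hfin : HasSum (fun k : ℤ => if k ∈ Finset.Icc (-(K : ℤ)) K then f k else 0)
      (∑ k ∈ Finset.Icc (-(K : ℤ)) K, f k) := by
    rw [← Finset.sum_congr rfl (fun k hk => if_pos (c := k ∈ Finset.Icc (-(K : ℤ)) K) hk)]
    exact hasSum_sum_of_ne_finset_zero fun k hk => if_neg hk
  rw [two_mul]
  refine (hf.sub hfin).norm_le_of_bounded hg fun k => ?_
  by_cases hk : k ∈ Finset.Icc (-(K : ℤ)) K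
  · rw [if_pos hk, sub_self, norm_zero, if_pos]
    rw [Finset.mem_Icc] at hk
    omega
  · rw [if_neg hk, sub_zero, if_neg]
    · exact hle k (by rw [Finset.mem_Icc] at hk; omega)
    · rw [Finset.mem_Icc] at hk; omega

/-- Half of the Gaussian exponent absorbs the linear factor, since |u| ≤ 1 + u²/4 ≤ e^{u²/4}. -/
theorem self_mul_exp_neg_le (u : ℝ) : |u * Real.exp (-u ^ 2 / 2)| ≤ Real.exp (-u ^ 2 / 4) := by
  have h1 : |u| ≤ Real.exp (u ^ 2 / 4) := by
    have := Real.add_one_le_exp (u ^ 2 / 4)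
    nlinarith [sq_nonneg (|u| / 2 - 1), sq_abs u]
  rw [abs_mul, Real.abs_exp]
  calc |u| * Real.exp (-u ^ 2 / 2) ≤ Real.exp (u ^ 2 / 4) * Real.exp (-u ^ 2 / 2) := by gcongr
    _ = Real.exp (-u ^ 2 / 4) := by rw [← Real.exp_add]; ring_nf

/-- Poisson summation for u e^{-u²/2}, which is its own Fourier transform up to a constant. It is
the functional equation of `jacobiTheta₂'` at z = -td/(2π), τ = i d²/(2π). -/
theorem hasSum_gaussian_poisson {d : ℝ} (hd : 0 < d) (t : ℝ) :
    HasSum (fun k : ℤ => Complex.I / (√(2 * Real.pi) : ℝ) *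
        (((d * (k * d) * Real.exp (-(k * d) ^ 2 / 2) : ℝ) : ℂ) *
          Complex.exp (-(Complex.I * (t * (k * d))))))
      (∑' n : ℤ, (((t + n * (2 * Real.pi / d)) *
        Real.exp (-(t + n * (2 * Real.pi / d)) ^ 2 / 2) : ℝ) : ℂ)) ∧
    Summable fun n : ℤ => (((t + n * (2 * Real.pi / d)) *
        Real.exp (-(t + n * (2 * Real.pi / d)) ^ 2 / 2) : ℝ) : ℂ) := by
  have hdC : (d : ℂ) ≠ 0 := by exact_mod_cast hd.ne'
  have hpi : (Real.pi : ℂ) ≠ 0 := by exact_mod_cast Real.pi_ne_zero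
  have hsq : ((√(2 * Real.pi) : ℝ) : ℂ) ≠ 0 := by
    exact_mod_cast (Real.sqrt_pos.2 (by positivity)).ne'
  set z : ℂ := -(t * d) / (2 * Real.pi) with hz
  set τ : ℂ := Complex.I * ((d ^ 2 / (2 * Real.pi) : ℝ) : ℂ) with hτ
  have hτim : 0 < τ.im := by
    rw [hτ, Complex.I_mul_im, Complex.ofReal_re]; positivity
  have hzτ : z / τ = Complex.I * t / d := by
    rw [hz, hτ]; push_cast; field_simp; simp
  have hτinv : -1 / τ = Complex.I * ((2 * Real.pi / d ^ 2 : ℝ) : ℂ) := by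
    rw [hτ]; push_cast; field_simp; simp
  have hτ'im : 0 < (-1 / τ).im := by
    rw [hτinv, Complex.I_mul_im, Complex.ofReal_re]; positivity
  have hroot : (-Complex.I * τ) ^ (1 / 2 : ℂ) = d / (√(2 * Real.pi) : ℝ) := by
    have h1 : -Complex.I * τ = ((d ^ 2 / (2 * Real.pi) : ℝ) : ℂ) := by
      rw [hτ, ← mul_assoc]; simp
    have h2 : (1 / 2 : ℂ) = ((1 / 2 : ℝ) : ℂ) := by norm_num
    rw [h1, h2, ← Complex.ofReal_cpow (by positivity), ← Real.sqrt_eq_rpow,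
      Real.sqrt_div (by positivity), Real.sqrt_sq hd.le]
    push_cast; rfl
  have hexp : Complex.exp (-Real.pi * Complex.I * z ^ 2 / τ) = Complex.exp (-(t : ℂ) ^ 2 / 2) := by
    congr 1
    rw [hz, hτ]; push_cast; field_simp
  have hA := hasSum_jacobiTheta₂'_term z hτim
  have hB := hasSum_jacobiTheta₂'_term (z / τ) hτ'im
  have hC := hasSum_jacobiTheta₂_term (z / τ) hτ'im
  -- The combination θ₂' - 2πi z θ₂ in the functional equation carries the factor n - z in each
  -- term; times 2π/d this is t + n(2π/d).
  have hD := (hB.sub (hC.mul_left (2 * Real.pi * Complex.I * z))).mul_left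
    (d / (2 * Real.pi * Complex.I * d ^ 2) * (2 * Real.pi) * Complex.exp (-(t : ℂ) ^ 2 / 2))
  have hE := hA.mul_left (Complex.I / (√(2 * Real.pi) : ℝ) * (d ^ 2 / (2 * Real.pi * Complex.I)))
  have hD' : HasSum (fun n : ℤ => (((t + n * (2 * Real.pi / d)) *
        Real.exp (-(t + n * (2 * Real.pi / d)) ^ 2 / 2) : ℝ) : ℂ))
      (d / (2 * Real.pi * Complex.I * d ^ 2) * (2 * Real.pi) * Complex.exp (-(t : ℂ) ^ 2 / 2) *
        (jacobiTheta₂' (z / τ) (-1 / τ) - 2 * Real.pi * Complex.I * z *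
          jacobiTheta₂ (z / τ) (-1 / τ))) := by
    refine (hasSum_congr_of_eq fun n => ?_).mpr hD
    have he : Complex.exp (-((t : ℂ) + n * (2 * Real.pi / d)) ^ 2 / 2) =
        Complex.exp (-(t : ℂ) ^ 2 / 2) * jacobiTheta₂_term n (z / τ) (-1 / τ) := by
      rw [jacobiTheta₂_term, ← Complex.exp_add, hzτ, hτinv]
      congr 1
      push_cast
      field_simp
      ring_nf
      simp only [Complex.I_sq]
      ring
    push_cast
    rw [he, jacobiTheta₂'_term, hz]
    field_simp
    ring
  refine ⟨?_, hD'.summable⟩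
  rw [hD'.tsum_eq]
  have hval : d / (2 * Real.pi * Complex.I * d ^ 2) * (2 * Real.pi) *
      Complex.exp (-(t : ℂ) ^ 2 / 2) * (jacobiTheta₂' (z / τ) (-1 / τ) - 2 * Real.pi * Complex.I *
        z * jacobiTheta₂ (z / τ) (-1 / τ)) = Complex.I / (√(2 * Real.pi) : ℝ) *
          (d ^ 2 / (2 * Real.pi * Complex.I)) * jacobiTheta₂' z τ := by
    rw [jacobiTheta₂'_functional_equation z τ, hroot, hexp, hτ]
    push_cast
    field_simp
  rw [hval]
  refine (hasSum_congr_of_eq fun k => ?_).mpr hE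
  · rw [jacobiTheta₂'_term, jacobiTheta₂_term]
    have he : Complex.exp (2 * Real.pi * Complex.I * k * z + Real.pi * Complex.I * k ^ 2 * τ) =
        Complex.exp (-((k : ℂ) * d) ^ 2 / 2) * Complex.exp (-(Complex.I * (t * (k * d)))) := by
      rw [← Complex.exp_add, hz, hτ]
      congr 1
      push_cast
      field_simp
      ring_nf
      simp only [Complex.I_sq]
      ring
    rw [he]
    push_cast
    field_simp

/-- The full sum over k is a sum over aliases t + nΛ with Λ = 2π/d, whose `n = 0` term is the
target. The first error term is the truncation at |k| ≤ K, the second the aliases with n ≠ 0. -/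
theorem norm_gaussian_fourier_sub_le {d Z : ℝ} (hd : 0 < d) {K : ℕ} (hZ : Z = K * d) (hZ0 : 0 < Z)
    {t : ℝ} (ht : |t| ≤ Real.pi / d) (hd1 : d ≤ 1) :
    ‖(∑ k ∈ Finset.Icc (-(K : ℤ)) K, Complex.I / (√(2 * Real.pi) : ℝ) *
        (((d * (k * d) * Real.exp (-(k * d) ^ 2 / 2) : ℝ) : ℂ) *
          Complex.exp (-(Complex.I * (t * (k * d)))))) - ((t * Real.exp (-t ^ 2 / 2) : ℝ) : ℂ)‖ ≤
      8 / Z * Real.exp (-Z ^ 2 / 4) + 3 * Real.exp (-(2 * Real.pi / d) ^ 2 / 16) := by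
  obtain ⟨h1, h2⟩ := hasSum_gaussian_poisson hd t
  set Λ := 2 * Real.pi / d with hΛ
  have hΛ0 : 0 < Λ := by positivity
  have hΛ6 : 6 ≤ Λ := by
    rw [hΛ, le_div_iff₀ hd]
    nlinarith [Real.pi_gt_three]
  have htΛ : |t| ≤ Λ / 2 := by rw [hΛ]; convert ht using 1; ring
  -- truncation
  have hsq1 : (1 : ℝ) ≤ √(2 * Real.pi) := by
    rw [Real.one_le_sqrt]; linarith [Real.pi_gt_three]
  have hA := norm_sub_sum_Icc_le_of_geometric h1 (B := d) (q := Real.exp (-(d * Z / 4)))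
    (Real.exp_pos _).le (by rw [Real.exp_lt_one_iff]; have := mul_pos hd hZ0; linarith) K
    (fun k hk => by
      have hkK : (K : ℝ) ≤ k.natAbs := by exact_mod_cast hk.le
      have hkabs : |(k : ℝ)| = k.natAbs := by rw [Nat.cast_natAbs]; push_cast; rfl
      rw [norm_mul, norm_mul, norm_div, Complex.norm_I, Complex.norm_real, Complex.norm_real,
        Real.norm_eq_abs, Real.norm_eq_abs, abs_of_pos (lt_of_lt_of_le one_pos hsq1)]
      have he : ‖Complex.exp (-(Complex.I * (t * (k * d))))‖ = 1 := by
        rw [Complex.norm_exp]; simp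
      rw [he, mul_one, mul_assoc d, abs_mul d, abs_of_pos hd]
      calc 1 / √(2 * Real.pi) * (d * |(k * d) * Real.exp (-(k * d) ^ 2 / 2)|)
          ≤ 1 * (d * Real.exp (-(k * d) ^ 2 / 4)) := by
            gcongr
            · rw [div_le_one (by linarith)]; exact hsq1
            · exact self_mul_exp_neg_le _
        -- For |k| > K one has k² ≥ K|k|, which turns the Gaussian tail into a geometric one of
        -- ratio e^{-dZ/4}.
        _ ≤ d * Real.exp (-(d * Z / 4)) ^ k.natAbs := by
            rw [one_mul, ← Real.exp_nat_mul]
            gcongr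
            rw [mul_pow, ← sq_abs (k : ℝ), hkabs, hZ]
            have : (K : ℝ) * k.natAbs ≤ (k.natAbs : ℝ) ^ 2 := by nlinarith
            nlinarith [mul_le_mul_of_nonneg_right this (sq_nonneg d)])
  have hA' : 2 * (d * Real.exp (-(d * Z / 4)) ^ (K + 1) / (1 - Real.exp (-(d * Z / 4)))) ≤
      8 / Z * Real.exp (-Z ^ 2 / 4) := by
    -- The inequality q·a ≤ 1 - q for q = e^{-a} is 1 + a ≤ e^a; it cancels the extra power of q and
    -- leaves q^K = e^{-Z²/4}.
    have hq1 : Real.exp (-(d * Z / 4)) * (d * Z / 4) ≤ 1 - Real.exp (-(d * Z / 4)) := by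
      have h3 := Real.add_one_le_exp (d * Z / 4)
      have h4 : Real.exp (-(d * Z / 4)) * Real.exp (d * Z / 4) = 1 := by
        rw [← Real.exp_add]; simp
      nlinarith [Real.exp_pos (-(d * Z / 4))]
    have hq0 : 0 < Real.exp (-(d * Z / 4)) * (d * Z / 4) := by positivity
    have hqK : Real.exp (-(d * Z / 4)) ^ K = Real.exp (-Z ^ 2 / 4) := by
      rw [← Real.exp_nat_mul]; congr 1; rw [hZ]; ring
    calc _ ≤ 2 * (d * Real.exp (-(d * Z / 4)) ^ (K + 1) /
          (Real.exp (-(d * Z / 4)) * (d * Z / 4))) := by gcongr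
      _ = 8 / Z * Real.exp (-Z ^ 2 / 4) := by
          rw [pow_succ, hqK]; field_simp; ring
  -- aliasing
  have hq3 : Real.exp (-Λ ^ 2 / 16) ≤ 1 / 3 := by
    have h3 := Real.add_one_le_exp (Λ ^ 2 / 16)
    have h4 : Real.exp (-Λ ^ 2 / 16) * Real.exp (Λ ^ 2 / 16) = 1 := by
      rw [← Real.exp_add]; ring_nf; simp
    nlinarith [Real.exp_pos (-Λ ^ 2 / 16)]
  have hB := norm_sub_sum_Icc_le_of_geometric h2.hasSum (B := 1) (q := Real.exp (-Λ ^ 2 / 16))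
    (Real.exp_pos _).le (by linarith) 0
    (fun n hn => by
      have hn1 : (1 : ℝ) ≤ n.natAbs := by exact_mod_cast hn
      have hnabs : |(n : ℝ)| = n.natAbs := by rw [Nat.cast_natAbs]; push_cast; rfl
      rw [Complex.norm_real, Real.norm_eq_abs, one_mul, ← Real.exp_nat_mul]
      refine (self_mul_exp_neg_le _).trans (Real.exp_le_exp.2 ?_)
      -- As |t| is at most half the alias period, the nth alias stays at distance at least |n|Λ/2
      -- from 0.
      have h5 : (n.natAbs : ℝ) * Λ / 2 ≤ |t + n * Λ| := by
        have h6 : |(n : ℝ) * Λ| = n.natAbs * Λ := by rw [abs_mul, hnabs, abs_of_pos hΛ0]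
        have h7 : |(n : ℝ) * Λ| ≤ |t + n * Λ| + |t| := by
          calc |(n : ℝ) * Λ| = |(t + n * Λ) - t| := by ring_nf
            _ ≤ _ := abs_sub _ _
        nlinarith
      have h8 : ((n.natAbs : ℝ) * Λ / 2) ^ 2 ≤ (t + n * Λ) ^ 2 := by
        rw [← sq_abs (t + n * Λ)]
        gcongr
      have h9 : (n.natAbs : ℝ) * Λ ^ 2 ≤ (n.natAbs : ℝ) ^ 2 * Λ ^ 2 := by
        gcongr; nlinarith
      nlinarith)
  have hB' : 2 * (1 * Real.exp (-Λ ^ 2 / 16) ^ (0 + 1) / (1 - Real.exp (-Λ ^ 2 / 16))) ≤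
      3 * Real.exp (-Λ ^ 2 / 16) := by
    rw [zero_add, pow_one, one_mul, ← mul_div_assoc, div_le_iff₀ (by linarith)]
    nlinarith [Real.exp_pos (-Λ ^ 2 / 16)]
  have hB0 : ∑ k ∈ Finset.Icc (-((0 : ℕ) : ℤ)) (0 : ℕ),
      (((t + k * Λ) * Real.exp (-(t + k * Λ) ^ 2 / 2) : ℝ) : ℂ) =
        ((t * Real.exp (-t ^ 2 / 2) : ℝ) : ℂ) := by
    simp
  rw [hB0] at hB
  rw [norm_sub_rev] at hA
  refine (norm_sub_le_norm_sub_add_norm_sub _ _ _).trans (add_le_add (hA.trans hA') (hB.trans hB'))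

/-! ### The Riemann sum -/

theorem hasDerivAt_neg_sq_div_two (s : ℝ) : HasDerivAt (fun s : ℝ => -s ^ 2 / 2) (-s) s := by
  have := ((hasDerivAt_pow 2 s).neg).div_const 2
  convert! this using 1
  simp
  ring

/-- The derivative of s e^{-s²/2} is at most 8/(1 + s²) in absolute value. Thus 8 arctan dominates
its variation, with a total increase on [0, ∞) of at most 4π. -/
theorem abs_sub_le_arctan_sub {a b : ℝ} (hab : a ≤ b) :
    |b * Real.exp (-b ^ 2 / 2) - a * Real.exp (-a ^ 2 / 2)| ≤
      8 * (Real.arctan b - Real.arctan a) := by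
  have hderiv : ∀ s : ℝ, HasDerivAt (fun s : ℝ => s * Real.exp (-s ^ 2 / 2))
      ((1 - s ^ 2) * Real.exp (-s ^ 2 / 2)) s := by
    intro s
    have := (hasDerivAt_id s).mul (hasDerivAt_neg_sq_div_two s).exp
    convert! this using 1
    simp; ring
  have hbound : ∀ s : ℝ, |(1 - s ^ 2) * Real.exp (-s ^ 2 / 2)| ≤ 8 * (1 / (1 + s ^ 2)) := by
    intro s
    rw [abs_mul, Real.abs_exp, mul_one_div, le_div_iff₀ (by positivity)]
    have h1 : |1 - s ^ 2| * (1 + s ^ 2) ≤ 8 * Real.exp (s ^ 2 / 2) := by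
      have h2 := Real.quadratic_le_exp_of_nonneg (show 0 ≤ s ^ 2 / 2 by positivity)
      have h3 : |1 - s ^ 2| ≤ 1 + s ^ 2 := by
        rw [abs_le]; constructor <;> nlinarith [sq_nonneg s]
      nlinarith [sq_nonneg s, sq_nonneg (s ^ 2)]
    have h4 : Real.exp (-s ^ 2 / 2) * Real.exp (s ^ 2 / 2) = 1 := by
      rw [← Real.exp_add]; ring_nf; simp
    have h5 := mul_le_mul_of_nonneg_right h1 (Real.exp_pos (-s ^ 2 / 2)).le
    nlinarith
  have key : ∀ σ : ℝ, |σ| = 1 → σ * (b * Real.exp (-b ^ 2 / 2) - a * Real.exp (-a ^ 2 / 2)) ≤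
      8 * (Real.arctan b - Real.arctan a) := by
    intro σ hσ
    have hmono : Monotone fun s : ℝ => 8 * Real.arctan s - σ * (s * Real.exp (-s ^ 2 / 2)) := by
      refine monotone_of_hasDerivAt_nonneg (f' := fun s => 8 * (1 / (1 + s ^ 2)) -
        σ * ((1 - s ^ 2) * Real.exp (-s ^ 2 / 2))) (fun s =>
        ((Real.hasDerivAt_arctan s).const_mul 8).sub ((hderiv s).const_mul σ)) fun s => ?_
      have := le_abs_self (σ * ((1 - s ^ 2) * Real.exp (-s ^ 2 / 2)))
      rw [abs_mul, hσ, one_mul] at this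
      exact sub_nonneg.2 (this.trans (hbound s))
    have := hmono hab
    simp only at this
    linarith
  rw [abs_le]
  constructor
  · have := key (-1) (by simp); linarith
  · have := key 1 (by simp); linarith

/-- One cell of the left Riemann sum for ∫ s e^{-s²/2} ds: the error is at most the width times the
variation on the cell, by the mean value inequality. -/
theorem abs_gaussian_step_le {a b : ℝ} (hab : a ≤ b) :
    |Real.exp (-a ^ 2 / 2) - Real.exp (-b ^ 2 / 2) - (b - a) * (a * Real.exp (-a ^ 2 / 2))| ≤
      (b - a) * (8 * (Real.arctan b - Real.arctan a)) := by
  have hderiv : ∀ s : ℝ, HasDerivAt (fun s : ℝ => -Real.exp (-s ^ 2 / 2) -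
      s * (a * Real.exp (-a ^ 2 / 2))) (s * Real.exp (-s ^ 2 / 2) - a * Real.exp (-a ^ 2 / 2)) s := by
    intro s
    have := (hasDerivAt_neg_sq_div_two s).exp.neg.sub ((hasDerivAt_id s).mul_const (a * Real.exp (-a ^ 2 / 2)))
    convert! this using 1
    simp; ring
  have := Convex.norm_image_sub_le_of_norm_hasDerivWithin_le (s := Set.Icc a b)
    (C := 8 * (Real.arctan b - Real.arctan a)) (fun s _ => (hderiv s).hasDerivWithinAt)
    (fun s hs => by
      refine (abs_sub_le_arctan_sub hs.1).trans ?_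
      have := Real.arctan_mono hs.2
      linarith) (convex_Icc a b) (Set.left_mem_Icc.2 hab) (Set.right_mem_Icc.2 hab)
  rw [Real.norm_eq_abs, Real.norm_eq_abs, abs_of_nonneg (sub_nonneg.2 hab)] at this
  refine le_trans (le_of_eq ?_) (this.trans_eq (mul_comm _ _))
  congr 1
  ring

/-- The cell errors telescope in arctan, so they add up to at most xD · 8 · π/2 < 13 xD for every J;
the prefactor 1/x then removes the dependence on x. -/
theorem abs_riemann_sum_sub_le {x D : ℝ} (hx : 0 < x) (hD : 0 < D) (J : ℕ) :
    |∑ j ∈ Finset.range J, D * (x * (j * D) * Real.exp (-(x * (j * D)) ^ 2 / 2)) -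
      1 / x * (1 - Real.exp (-(x * (J * D)) ^ 2 / 2))| ≤ D * 13 := by
  have h1 : ∀ J : ℕ, |∑ j ∈ Finset.range J, x * D * (x * (j * D) *
      Real.exp (-(x * (j * D)) ^ 2 / 2)) - (1 - Real.exp (-(x * (J * D)) ^ 2 / 2))| ≤
        x * D * (8 * Real.arctan (x * (J * D))) := by
    intro J
    induction J with
    | zero => simp
    | succ n ih =>
      rw [Finset.sum_range_succ]
      have h2 := abs_gaussian_step_le (a := x * (n * D)) (b := x * ((n + 1 : ℕ) * D))
        (by gcongr; simp)
      have h3 : x * ((n + 1 : ℕ) * D) - x * (n * D) = x * D := by push_cast; ring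
      rw [h3] at h2
      rw [abs_le] at ih h2 ⊢
      constructor <;> linarith [ih.1, ih.2, h2.1, h2.2]
  have h2 := (h1 J).trans (mul_le_mul_of_nonneg_left (mul_le_mul_of_nonneg_left
    (Real.arctan_lt_pi_div_two _).le (by norm_num : (0 : ℝ) ≤ 8)) (by positivity))
  have h3 : x * D * (8 * (Real.pi / 2)) ≤ x * (D * 13) := by
    have : 8 * (Real.pi / 2) ≤ 13 := by linarith [Real.pi_lt_d2]
    calc x * D * (8 * (Real.pi / 2)) ≤ x * D * 13 := by gcongr
      _ = _ := by ring
  have h4 : ∑ j ∈ Finset.range J, D * (x * (j * D) * Real.exp (-(x * (j * D)) ^ 2 / 2)) -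
      1 / x * (1 - Real.exp (-(x * (J * D)) ^ 2 / 2)) = (1 / x) * (∑ j ∈ Finset.range J,
        x * D * (x * (j * D) * Real.exp (-(x * (j * D)) ^ 2 / 2)) -
          (1 - Real.exp (-(x * (J * D)) ^ 2 / 2))) := by
    conv_rhs => rw [mul_sub, Finset.mul_sum]
    congr 1
    refine Finset.sum_congr rfl fun j _ => ?_
    field_simp
  rw [h4, abs_mul, abs_of_pos (by positivity)]
  calc 1 / x * _ ≤ 1 / x * (x * (D * 13)) := by gcongr; exact h2.trans h3
    _ = D * 13 := by field_simp

/-! ### The Fourier decomposition of the inverse -/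

namespace FourierParams

variable (P : FourierParams)

theorem g_neg (x : ℝ) : P.g (-x) = -P.g x := by
  unfold g
  rw [← mul_neg, ← Finset.sum_neg_distrib]
  congr 1
  refine Finset.sum_congr rfl fun j _ => ?_
  rw [← mul_neg, ← Finset.sum_neg_distrib]
  congr 1
  refine Finset.sum_nbij' (fun k => -k) (fun k => -k) ?_ ?_ ?_ ?_ ?_
  · intro k hk; rw [Finset.mem_Icc] at hk ⊢; omega
  · intro k hk; rw [Finset.mem_Icc] at hk ⊢; omega
  · simp
  · simp
  · intro k _
    have hz : P.z (-k) = -P.z k := by simp [z]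
    rw [hz, neg_sq]
    push_cast
    ring_nf

/-- Makes g agree with the convention `0⁻¹ = 0`, so the kernel of H adds no error. -/
theorem g_zero : P.g 0 = 0 := by
  have := P.g_neg 0
  rw [neg_zero] at this
  exact self_eq_neg.1 this

/-- The three errors are: the z-discretization, weighted by the total y-length Y; the Riemann sum in
y; and the missing tail y > Y. The condition Y ≤ π/Δz keeps every x y_j within half an alias period.
-/
theorem norm_inv_sub_g_le_of_pos {Y Z x : ℝ} (hy : 0 < P.Δy) (hz : 0 < P.Δz) (hz1 : P.Δz ≤ 1)
    (hY : Y = P.J * P.Δy) (hZ : Z = P.K * P.Δz) (hZ0 : 0 < Z) (hYz : Y ≤ Real.pi / P.Δz)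
    (hx : 0 < x) (hx1 : x ≤ 1) :
    ‖((1 / x : ℝ) : ℂ) - P.g x‖ ≤
      Y * (8 / Z * Real.exp (-Z ^ 2 / 4) + 3 * Real.exp (-(2 * Real.pi / P.Δz) ^ 2 / 16)) +
        P.Δy * 13 + 1 / x * Real.exp (-(x * Y) ^ 2 / 2) := by
  set E := 8 / Z * Real.exp (-Z ^ 2 / 4) + 3 * Real.exp (-(2 * Real.pi / P.Δz) ^ 2 / 16) with hE
  have hg : P.g x = ∑ j ∈ Finset.range P.J, (P.Δy : ℂ) *
      ∑ k ∈ Finset.Icc (-(P.K : ℤ)) P.K, Complex.I / (√(2 * Real.pi) : ℝ) *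
        (((P.Δz * (k * P.Δz) * Real.exp (-(k * P.Δz) ^ 2 / 2) : ℝ) : ℂ) *
          Complex.exp (-(Complex.I * (((x * (j * P.Δy) : ℝ) : ℂ) * (k * P.Δz))))) := by
    rw [g, Finset.mul_sum]
    refine Finset.sum_congr rfl fun j _ => ?_
    rw [mul_left_comm, Finset.mul_sum]
    congr 1
    refine Finset.sum_congr rfl fun k _ => ?_
    simp only [y, z]
    push_cast
    rfl
  have h1 : ‖P.g x - ((∑ j ∈ Finset.range P.J, P.Δy * (x * (j * P.Δy) *
      Real.exp (-(x * (j * P.Δy)) ^ 2 / 2)) : ℝ) : ℂ)‖ ≤ Y * E := by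
    rw [hg, Complex.ofReal_sum, ← Finset.sum_sub_distrib]
    refine (norm_sum_le_of_le (f := fun j : ℕ => _) _ (fun j hj => ?_) :
      _ ≤ ∑ j ∈ Finset.range P.J, P.Δy * E).trans_eq ?_
    · rw [Complex.ofReal_mul P.Δy, ← mul_sub, norm_mul, Complex.norm_real, Real.norm_eq_abs,
        abs_of_pos hy]
      refine mul_le_mul_of_nonneg_left ?_ hy.le
      refine norm_gaussian_fourier_sub_le hz hZ hZ0 ?_ hz1
      rw [abs_of_nonneg (by positivity)]
      refine le_trans ?_ hYz
      have : (j : ℝ) ≤ P.J := by exact_mod_cast (Finset.mem_range.1 hj).le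
      calc x * (j * P.Δy) ≤ 1 * (P.J * P.Δy) := by gcongr
        _ = Y := by rw [hY, one_mul]
    · rw [Finset.sum_const, Finset.card_range, nsmul_eq_mul, hY]; ring
  have h2 := abs_riemann_sum_sub_le hx hy P.J
  rw [← hY] at h2
  set R := ∑ j ∈ Finset.range P.J, P.Δy * (x * (j * P.Δy) *
      Real.exp (-(x * (j * P.Δy)) ^ 2 / 2)) with hR
  have h3 : |1 / x - R| ≤ P.Δy * 13 + 1 / x * Real.exp (-(x * Y) ^ 2 / 2) := by
    have h4 : 0 < 1 / x * Real.exp (-(x * Y) ^ 2 / 2) := by positivity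
    rw [abs_le] at h2 ⊢
    constructor <;> linarith [h2.1, h2.2]
  have h5 : ‖((1 / x : ℝ) : ℂ) - (R : ℂ)‖ ≤
      P.Δy * 13 + 1 / x * Real.exp (-(x * Y) ^ 2 / 2) := by
    rw [← Complex.ofReal_sub, Complex.norm_real]; exact h3
  rw [norm_sub_rev] at h1
  calc _ ≤ ‖((1 / x : ℝ) : ℂ) - (R : ℂ)‖ + ‖(R : ℂ) - P.g x‖ := norm_sub_le_norm_sub_add_norm_sub _ _ _
    _ ≤ _ := by linarith

theorem norm_inv_sub_g_le {Y Z x κ : ℝ} (hκ : 1 ≤ κ) (hy : 0 < P.Δy) (hz : 0 < P.Δz)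
    (hz1 : P.Δz ≤ 1)
    (hY : Y = P.J * P.Δy) (hZ : Z = P.K * P.Δz) (hZ0 : 0 < Z) (hYz : Y ≤ Real.pi / P.Δz)
    (hx : x ∈ invDomain κ) :
    ‖((1 / x : ℝ) : ℂ) - P.g x‖ ≤
      Y * (8 / Z * Real.exp (-Z ^ 2 / 4) + 3 * Real.exp (-(2 * Real.pi / P.Δz) ^ 2 / 16)) +
        P.Δy * 13 + κ * Real.exp (-(Y / κ) ^ 2 / 2) := by
  have hpos : ∀ x : ℝ, x ∈ Set.Icc (1 / κ) 1 → ‖((1 / x : ℝ) : ℂ) - P.g x‖ ≤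
      Y * (8 / Z * Real.exp (-Z ^ 2 / 4) + 3 * Real.exp (-(2 * Real.pi / P.Δz) ^ 2 / 16)) +
        P.Δy * 13 + κ * Real.exp (-(Y / κ) ^ 2 / 2) := by
    intro x hx
    have hκ0 : 0 < κ := by linarith
    have hx0 : 0 < x := lt_of_lt_of_le (by positivity) hx.1
    refine (P.norm_inv_sub_g_le_of_pos hy hz hz1 hY hZ hZ0 hYz hx0 hx.2).trans ?_
    have hxκ : 1 / x ≤ κ := by
      rw [div_le_iff₀ hx0]
      have := mul_le_mul_of_nonneg_left hx.1 hκ0.le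
      rwa [mul_one_div_cancel hκ0.ne'] at this
    have hY0 : 0 ≤ Y := by rw [hY]; positivity
    have hexp : Real.exp (-(x * Y) ^ 2 / 2) ≤ Real.exp (-(Y / κ) ^ 2 / 2) := by
      have : Y / κ ≤ x * Y := by
        rw [div_eq_mul_one_div, mul_comm]; exact mul_le_mul_of_nonneg_right hx.1 hY0
      have h2 : (Y / κ) ^ 2 ≤ (x * Y) ^ 2 := by gcongr
      rw [Real.exp_le_exp]; linarith
    gcongr
  rcases hx with hx | hx
  · have := hpos (-x) ⟨by linarith [hx.2], by linarith [hx.1]⟩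
    rw [g_neg, ← norm_neg] at this
    have h : -(((1 / -x : ℝ) : ℂ) - -P.g x) = ((1 / x : ℝ) : ℂ) - P.g x := by
      push_cast
      rw [div_neg]
      ring
    rwa [h] at this
  · exact hpos x hx

theorem exists_isTheta_norm_inv_sub_g_le : ∃ A : ℝ, 1 ≤ A ∧ ∀ κ γ : ℝ, 1 ≤ κ → 0 < γ → γ ≤ 1 / 2 →
    ∃ P : FourierParams, P.IsTheta A κ γ ∧
      ∀ x ∈ invDomain κ, ‖((1 / x : ℝ) : ℂ) - P.g x‖ ≤ γ := by
  refine ⟨1000, by norm_num, fun κ γ hκ hγ0 hγ => ?_⟩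
  have hκ0 : 0 < κ := by linarith
  set r := κ / γ with hr
  have hr2 : 2 ≤ r := by rw [hr, le_div_iff₀ hγ0]; linarith
  have hr0 : 0 < r := by linarith
  set L := Real.log r with hL
  have hL1 : 0.69 ≤ L := by
    have h1 := Real.log_le_log (by norm_num) hr2
    have h2 := Real.log_two_gt_d9
    rw [hL]; linarith
  have hL0 : 0 < L := by linarith
  have hLr : L ≤ r := (Real.log_le_sub_one_of_pos hr0).trans (by linarith)
  set s := √L with hs
  have hss : s ^ 2 = L := Real.sq_sqrt hL0.le
  have hs1 : 0.83 ≤ s := by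
    rw [hs]; apply Real.le_sqrt_of_sq_le; linarith
  have hs0 : 0 < s := by linarith
  have hsr : s ≤ r := by
    nlinarith
  have hγκ : γ * r = κ := by rw [hr]; field_simp
  have hrL : 1 ≤ r * L := by nlinarith
  have hκL : 0.69 ≤ κ * L := by nlinarith
  -- the parameters
  set J := ⌈400 * (r * L)⌉₊ with hJ
  set K := ⌈12 * (κ * L)⌉₊ with hK
  have hJl : 400 * (r * L) ≤ J := Nat.le_ceil _
  have hJu : (J : ℝ) ≤ 400 * (r * L) + 1 := (Nat.ceil_lt_add_one (by positivity)).le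
  have hKl : 12 * (κ * L) ≤ K := Nat.le_ceil _
  have hKu : (K : ℝ) ≤ 12 * (κ * L) + 1 := (Nat.ceil_lt_add_one (by positivity)).le
  set Y := J * (1 / 100 * (γ / s)) with hY
  set Z := K * (1 / 2 * (κ * s)⁻¹) with hZ
  have hYl : 4 * (κ * s) ≤ Y := by
    calc 4 * (κ * s) = 400 * (r * L) * (1 / 100 * (γ / s)) := by
          rw [← hss, ← hγκ]; field_simp; ring
      _ ≤ Y := by rw [hY]; gcongr
  have hYu : Y ≤ 5 * (κ * s) := by
    calc Y ≤ (500 * (r * L)) * (1 / 100 * (γ / s)) := by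
          rw [hY]; gcongr; linarith
      _ = 5 * (κ * s) := by rw [← hss, ← hγκ]; field_simp; ring
  have hZl : 6 * s ≤ Z := by
    calc 6 * s = 12 * (κ * L) * (1 / 2 * (κ * s)⁻¹) := by
          rw [← hss]; field_simp; ring
      _ ≤ Z := by rw [hZ]; gcongr
  have hZ0 : 0 < Z := by linarith
  have hexp : ∀ n : ℕ, Real.exp (-(n * L)) = (r ^ n)⁻¹ := by
    intro n
    rw [Real.exp_neg, Real.exp_nat_mul, hL, Real.exp_log hr0]
  refine ⟨⟨J, K, 1 / 100 * (γ / s), 1 / 2 * (κ * s)⁻¹⟩, ?_, fun x hx => ?_⟩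
  · constructor <;> simp only <;> try rw [← hr, ← hL]
    · linarith
    · linarith
    · linarith
    · linarith
    · rw [← hs]; gcongr; norm_num
    · rw [← hs]; gcongr; norm_num
    · rw [← hs]; gcongr; norm_num
    · rw [← hs]; gcongr; norm_num
  have hκs : 0.83 ≤ κ * s := by nlinarith
  refine (norm_inv_sub_g_le _ (Y := Y) (Z := Z) hκ ?_ ?_ ?_ rfl rfl hZ0 ?_ hx).trans ?_
  · simp only; positivity
  · simp only; positivity
  · simp only
    have : (κ * s)⁻¹ ≤ 1 / 0.83 := by rw [inv_eq_one_div]; gcongr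
    norm_num at this ⊢
    linarith
  · simp only
    rw [le_div_iff₀ (by positivity)]
    calc Y * (1 / 2 * (κ * s)⁻¹) ≤ 5 * (κ * s) * (1 / 2 * (κ * s)⁻¹) := by gcongr
      _ = 2.5 := by field_simp; norm_num
      _ ≤ Real.pi := by linarith [Real.pi_gt_three]
  · simp only
    have hΛ : 12 * s ≤ 2 * Real.pi / (1 / 2 * (κ * s)⁻¹) := by
      rw [le_div_iff₀ (by positivity)]
      calc 12 * s * (1 / 2 * (κ * s)⁻¹) = 6 / κ := by field_simp; norm_num
        _ ≤ 6 := div_le_self (by norm_num) hκ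
        _ ≤ 2 * Real.pi := by linarith [Real.pi_gt_three]
    have hsqL : ∀ a X : ℝ, 0 ≤ a → a * s ≤ X → a ^ 2 * L ≤ X ^ 2 := by
      intro a X ha h
      rw [← hss, ← mul_pow]
      gcongr
    have hE1 : Real.exp (-Z ^ 2 / 4) ≤ (r ^ 9)⁻¹ := by
      have h := hsqL _ _ (by norm_num) hZl
      rw [← hexp, Real.exp_le_exp]; push_cast; linarith
    have hE2 : Real.exp (-(2 * Real.pi / (1 / 2 * (κ * s)⁻¹)) ^ 2 / 16) ≤ (r ^ 9)⁻¹ := by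
      have h := hsqL _ _ (by norm_num) hΛ
      rw [← hexp, Real.exp_le_exp]; push_cast; linarith
    have hE3 : Real.exp (-(Y / κ) ^ 2 / 2) ≤ (r ^ 8)⁻¹ := by
      have : 4 * s ≤ Y / κ := by rw [le_div_iff₀ hκ0]; linarith
      have h := hsqL _ _ (by norm_num) this
      rw [← hexp, Real.exp_le_exp]; push_cast; linarith
    have hr7 : (r ^ 7)⁻¹ ≤ 1 / 128 := by
      rw [inv_eq_one_div]
      have : (2 : ℝ) ^ 7 ≤ r ^ 7 := by gcongr
      gcongr
      linarith
    have hr8 : κ * (r ^ 8)⁻¹ = γ * (r ^ 7)⁻¹ := by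
      rw [← hγκ]; field_simp
    have hr9 : κ * (r ^ 9)⁻¹ ≤ γ * (r ^ 7)⁻¹ := by
      rw [← hr8]
      gcongr
      · linarith
      · norm_num
    have hr9' : κ * s * (r ^ 9)⁻¹ ≤ γ * (r ^ 7)⁻¹ := by
      rw [← hr8]
      calc κ * s * (r ^ 9)⁻¹ ≤ κ * r * (r ^ 9)⁻¹ := by gcongr
        _ = κ * (r ^ 8)⁻¹ := by field_simp
    have hT1 : Y * (8 / Z * Real.exp (-Z ^ 2 / 4)) ≤ 20 / 3 * (γ * (r ^ 7)⁻¹) := by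
      calc _ ≤ 5 * (κ * s) * (8 / (6 * s) * (r ^ 9)⁻¹) := by gcongr
        _ = 20 / 3 * (κ * (r ^ 9)⁻¹) := by field_simp; norm_num
        _ ≤ _ := by gcongr
    have hT2 : Y * (3 * Real.exp (-(2 * Real.pi / (1 / 2 * (κ * s)⁻¹)) ^ 2 / 16)) ≤
        15 * (γ * (r ^ 7)⁻¹) := by
      calc _ ≤ 5 * (κ * s) * (3 * (r ^ 9)⁻¹) := by gcongr
        _ = 15 * (κ * s * (r ^ 9)⁻¹) := by ring
        _ ≤ _ := by gcongr
    have hT3 : 1 / 100 * (γ / s) * 13 ≤ 1 / 5 * γ := by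
      calc 1 / 100 * (γ / s) * 13 ≤ 1 / 100 * (γ / (83 / 100)) * 13 := by
            gcongr
            linarith
        _ ≤ _ := by linarith
    have hT4 : κ * Real.exp (-(Y / κ) ^ 2 / 2) ≤ γ * (r ^ 7)⁻¹ := by
      rw [← hr8]; gcongr
    have hγ7 : γ * (r ^ 7)⁻¹ ≤ γ * (1 / 128) := by gcongr
    -- The exponential errors total at most (20/3 + 15 + 1)γ/128 and the Riemann error at most γ/5,
    -- which is less than γ together.
    rw [mul_add]
    linarith

end FourierParams

/-! ### Functional calculus of a Hermitian matrix -/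

section FunctionalCalculus

variable {N : ℕ} {H : Matrix (Fin N) (Fin N) ℂ}

/-- The matrix with the eigenvectors of `H` and the values `f` in place of the eigenvalues. -/
noncomputable def spectralMap (hH : H.IsHermitian) : (Fin N → ℂ) →ₐ[ℂ] Matrix (Fin N) (Fin N) ℂ :=
  ((Unitary.conjStarAlgAut ℂ (Matrix (Fin N) (Fin N) ℂ) hH.eigenvectorUnitary :
    Matrix (Fin N) (Fin N) ℂ ≃⋆ₐ[ℂ] Matrix (Fin N) (Fin N) ℂ) :
      Matrix (Fin N) (Fin N) ℂ →ₐ[ℂ] Matrix (Fin N) (Fin N) ℂ).comp (Matrix.diagonalAlgHom ℂ)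

theorem spectralMap_apply (hH : H.IsHermitian) (f : Fin N → ℂ) :
    spectralMap hH f = (hH.eigenvectorUnitary : Matrix (Fin N) (Fin N) ℂ) * Matrix.diagonal f *
      star (hH.eigenvectorUnitary : Matrix (Fin N) (Fin N) ℂ) := rfl

theorem continuous_spectralMap (hH : H.IsHermitian) : Continuous (spectralMap hH) := by
  have : (spectralMap hH : (Fin N → ℂ) → Matrix (Fin N) (Fin N) ℂ) = fun f =>
    (hH.eigenvectorUnitary : Matrix (Fin N) (Fin N) ℂ) * Matrix.diagonal f *
      star (hH.eigenvectorUnitary : Matrix (Fin N) (Fin N) ℂ) := funext (spectralMap_apply hH)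
  rw [this]
  fun_prop

theorem star_spectralMap (hH : H.IsHermitian) (f : Fin N → ℂ) :
    star (spectralMap hH f) = spectralMap hH (star f) := by
  rw [spectralMap_apply, spectralMap_apply, star_mul, star_mul, star_star, mul_assoc,
    Matrix.star_eq_conjTranspose (Matrix.diagonal f), Matrix.diagonal_conjTranspose]

/-- Conjugation by a unitary is isometric and a diagonal matrix has the sup norm of its entries;
this carries scalar bounds on the eigenvalues over to matrices. -/
theorem norm_spectralMap (hH : H.IsHermitian) (f : Fin N → ℂ) : ‖spectralMap hH f‖ = ‖f‖ := by
  rw [spectralMap_apply, ← Unitary.coe_star, CStarRing.norm_mul_coe_unitary,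
    CStarRing.norm_coe_unitary_mul, Matrix.l2_opNorm_diagonal]

theorem spectralMap_eigenvalues (hH : H.IsHermitian) :
    spectralMap hH (fun i => (hH.eigenvalues i : ℂ)) = H :=
  hH.spectral_theorem.symm

theorem hermInv_eq_spectralMap (hH : H.IsHermitian) :
    hermInv hH = spectralMap hH fun i => (((hH.eigenvalues i)⁻¹ : ℝ) : ℂ) := rfl

theorem evolution_eq_spectralMap (hH : H.IsHermitian) (t : ℝ) :
    FourierParams.evolution H t =
      spectralMap hH fun i => Complex.exp (-(Complex.I * t) * hH.eigenvalues i) := by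
  have h1 : -(Complex.I * t) • H =
      spectralMap hH (-(Complex.I * t) • fun i => (hH.eigenvalues i : ℂ)) := by
    rw [map_smul, spectralMap_eigenvalues]
  rw [FourierParams.evolution, h1, ← NormedSpace.map_exp _ (continuous_spectralMap hH)]
  congr 1
  funext i
  rw [Pi.coe_exp, Complex.exp_eq_exp_ℂ]
  rfl

theorem star_evolution_mul_self (hH : H.IsHermitian) (t : ℝ) :
    star (FourierParams.evolution H t) * FourierParams.evolution H t = 1 := by
  rw [evolution_eq_spectralMap hH, star_spectralMap, ← map_mul, ← map_one (spectralMap hH)]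
  congr 1
  funext i
  rw [Pi.mul_apply, Pi.star_apply, Complex.star_def, ← Complex.exp_conj, ← Complex.exp_add]
  simp

namespace FourierParams

variable (P : FourierParams)

theorem star_unitary_mul_self (hH : H.IsHermitian) (p : P.Index) :
    star (P.unitary H p) * P.unitary H p = 1 := by
  rw [unitary, star_smul, smul_mul_smul_comm, star_evolution_mul_self hH]
  split_ifs <;> simp

theorem gMat_eq_spectralMap (hH : H.IsHermitian) :
    P.gMat H = spectralMap hH fun i => P.g (hH.eigenvalues i) := by
  simp only [gMat, evolution_eq_spectralMap hH, ← map_smul, ← map_sum]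
  congr 1
  funext i
  simp only [Pi.smul_apply, Finset.sum_apply, smul_eq_mul, g]
  congr 1
  refine Finset.sum_congr rfl fun j _ => ?_
  congr 1
  refine Finset.sum_congr rfl fun k _ => ?_
  congr 2
  push_cast
  ring

theorem norm_hermInv_sub_gMat_le (hH : H.IsHermitian) {κ γ : ℝ} (hγ : 0 ≤ γ)
    (hspec : ∀ i, hH.eigenvalues i ≠ 0 → hH.eigenvalues i ∈ invDomain κ)
    (hg : ∀ x ∈ invDomain κ, ‖((1 / x : ℝ) : ℂ) - P.g x‖ ≤ γ) :
    ‖hermInv hH - P.gMat H‖ ≤ γ := by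
  rw [hermInv_eq_spectralMap, gMat_eq_spectralMap P hH, ← map_sub, norm_spectralMap,
    pi_norm_le_iff_of_nonneg hγ]
  intro i
  rw [Pi.sub_apply]
  by_cases h : hH.eigenvalues i = 0
  · simp [h, g_zero, hγ]
  · simpa only [one_div] using hg _ (hspec i h)

end FourierParams

end FunctionalCalculus

theorem norm_toEuclideanCLM_of_star_mul_self {N : ℕ} {V : Matrix (Fin N) (Fin N) ℂ}
    (hV : star V * V = 1) (x : EuclideanSpace ℂ (Fin N)) :
    ‖Matrix.toEuclideanCLM (n := Fin N) (𝕜 := ℂ) V x‖ = ‖x‖ := by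
  refine (ContinuousLinearMap.norm_map_iff_adjoint_comp_self _).2 ?_ x
  rw [← ContinuousLinearMap.star_eq_adjoint, ← map_star]
  exact (map_mul _ _ _).symm.trans ((congrArg _ hV).trans (map_one _))

/-- The vector `H⁻¹|b⟩` has norm at least `1` if `|b⟩` is in the range of `H` and `‖H‖ ≤ 1`. -/
theorem one_le_norm_hermInv {N : ℕ} {H : Matrix (Fin N) (Fin N) ℂ} (hH : H.IsHermitian) {κ : ℝ}
    (hκ : 1 ≤ κ)
    (hspec : ∀ i, hH.eigenvalues i ≠ 0 → hH.eigenvalues i ∈ invDomain κ)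
    {b : EuclideanSpace ℂ (Fin N)} (hb : ‖b‖ = 1)
    (hrange : ∃ v, Matrix.toEuclideanCLM (n := Fin N) (𝕜 := ℂ) H v = b) :
    1 ≤ ‖Matrix.toEuclideanCLM (n := Fin N) (𝕜 := ℂ) (hermInv hH) b‖ := by
  obtain ⟨v, rfl⟩ := hrange
  -- On the range of H this identity says b = H(H⁻¹b), so ‖H‖ ≤ 1 yields 1 = ‖b‖ ≤ ‖H⁻¹b‖.
  have h1 : H * hermInv hH * H = H := by
    have h : spectralMap hH (fun i => (hH.eigenvalues i : ℂ)) *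
        spectralMap hH (fun i => (((hH.eigenvalues i)⁻¹ : ℝ) : ℂ)) *
          spectralMap hH (fun i => (hH.eigenvalues i : ℂ)) =
            spectralMap hH (fun i => (hH.eigenvalues i : ℂ)) := by
      rw [← map_mul, ← map_mul]
      congr 1
      funext i
      simp only [Pi.mul_apply]
      by_cases h : hH.eigenvalues i = 0
      · simp [h]
      · exact_mod_cast by field_simp
    rwa [spectralMap_eigenvalues, ← hermInv_eq_spectralMap] at h
  have h2 : ‖H‖ ≤ 1 := by
    have h3 := norm_spectralMap hH (fun i => (hH.eigenvalues i : ℂ))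
    rw [spectralMap_eigenvalues] at h3
    rw [h3, pi_norm_le_iff_of_nonneg zero_le_one]
    intro i
    rw [Complex.norm_real, Real.norm_eq_abs]
    by_cases h : hH.eigenvalues i = 0
    · simp [h]
    · have hκ' : 0 < 1 / κ := by positivity
      rcases hspec i h with h | h
      · rw [abs_le]; exact ⟨h.1, by linarith [h.2]⟩
      · rw [abs_le]; exact ⟨by linarith [h.1], h.2⟩
  have h4 : Matrix.toEuclideanCLM (n := Fin N) (𝕜 := ℂ) H
      (Matrix.toEuclideanCLM (n := Fin N) (𝕜 := ℂ) (hermInv hH)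
        (Matrix.toEuclideanCLM (n := Fin N) (𝕜 := ℂ) H v)) =
          Matrix.toEuclideanCLM (n := Fin N) (𝕜 := ℂ) H v := by
    conv_rhs => rw [← h1, map_mul, map_mul]
    rfl
  have h5 := (Matrix.toEuclideanCLM (n := Fin N) (𝕜 := ℂ) H).le_opNorm
    (Matrix.toEuclideanCLM (n := Fin N) (𝕜 := ℂ) (hermInv hH)
        (Matrix.toEuclideanCLM (n := Fin N) (𝕜 := ℂ) H v))
  rw [h4, hb, Matrix.l2_opNorm_toEuclideanCLM] at h5
  nlinarith [norm_nonneg (Matrix.toEuclideanCLM (n := Fin N) (𝕜 := ℂ) (hermInv hH)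
        (Matrix.toEuclideanCLM (n := Fin N) (𝕜 := ℂ) H v))]

/-! ### Measurement of a pure state -/

section Measurement

variable {m : Type*} [Fintype m] [DecidableEq m] {A : Matrix m m ℂ}

theorem measureLaw_vecMulVec (hA : A.IsHermitian) (w : EuclideanSpace ℂ m) :
    measureLaw hA (Matrix.vecMulVec w.ofLp (star w.ofLp)) =
      ∑ i, ENNReal.ofReal (‖inner ℂ (hA.eigenvectorBasis i) w‖ ^ 2) •
        MeasureTheory.Measure.dirac (hA.eigenvalues i) := by
  unfold measureLaw
  refine Finset.sum_congr rfl fun i _ => ?_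
  congr 2
  set v := hA.eigenvectorBasis i
  have h1 : star v.ofLp ⬝ᵥ w.ofLp = inner ℂ v w := by
    rw [EuclideanSpace.inner_eq_star_dotProduct, dotProduct_comm]
  have h2 : star w.ofLp ⬝ᵥ v.ofLp = inner ℂ w v := by
    rw [EuclideanSpace.inner_eq_star_dotProduct, dotProduct_comm]
  rw [Matrix.vecMulVec_mulVec, dotProduct_smul, h1, h2, op_smul_eq_mul,
    ← inner_conj_symm w v, Complex.mul_conj, Complex.ofReal_re, Complex.normSq_eq_norm_sq]

theorem isProbabilityMeasure_measureLaw (hA : A.IsHermitian) {w : EuclideanSpace ℂ m}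
    (hw : ‖w‖ = 1) : MeasureTheory.IsProbabilityMeasure
      (measureLaw hA (Matrix.vecMulVec w.ofLp (star w.ofLp))) := by
  constructor
  rw [measureLaw_vecMulVec, MeasureTheory.Measure.finsetSum_apply]
  simp only [MeasureTheory.Measure.smul_apply, MeasureTheory.measure_univ, smul_eq_mul, mul_one]
  rw [← ENNReal.ofReal_sum_of_nonneg fun i _ => by positivity,
    hA.eigenvectorBasis.sum_sq_norm_inner_right, hw]
  simp

theorem integral_measureLaw (hA : A.IsHermitian) (w : EuclideanSpace ℂ m) :
    ∫ x, x ∂(measureLaw hA (Matrix.vecMulVec w.ofLp (star w.ofLp))) =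
      (inner ℂ w (Matrix.toEuclideanCLM (n := m) (𝕜 := ℂ) A w)).re := by
  have hb : ∀ i, inner ℂ (hA.eigenvectorBasis i) (Matrix.toEuclideanCLM (n := m) (𝕜 := ℂ) A w) =
      (hA.eigenvalues i : ℂ) * inner ℂ (hA.eigenvectorBasis i) w := by
    intro i
    have hadj : star (Matrix.toEuclideanCLM (n := m) (𝕜 := ℂ) A) =
        Matrix.toEuclideanCLM (n := m) (𝕜 := ℂ) A := by
      rw [← map_star]; exact congrArg _ hA
    have heig : Matrix.toEuclideanCLM (n := m) (𝕜 := ℂ) A (hA.eigenvectorBasis i) =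
        (hA.eigenvalues i : ℂ) • hA.eigenvectorBasis i := by
      apply WithLp.ofLp_injective
      rw [Matrix.ofLp_toEuclideanCLM]
      exact hA.mulVec_eigenvectorBasis i
    conv_lhs => rw [← hadj, ContinuousLinearMap.star_eq_adjoint,
      ContinuousLinearMap.adjoint_inner_right, heig]
    rw [inner_smul_left, Complex.conj_ofReal]
  rw [measureLaw_vecMulVec, MeasureTheory.integral_finsetSum_measure
    fun i _ => (MeasureTheory.integrable_dirac (by simp)).smul_measure ENNReal.ofReal_ne_top,
    ← hA.eigenvectorBasis.sum_inner_mul_inner, Complex.re_sum]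
  refine Finset.sum_congr rfl fun i _ => ?_
  rw [MeasureTheory.integral_smul_measure, MeasureTheory.integral_dirac,
    ENNReal.toReal_ofReal (by positivity), hb, smul_eq_mul, mul_left_comm,
    ← inner_conj_symm w, mul_comm (starRingEnd ℂ _), Complex.mul_conj, ← Complex.ofReal_mul,
    Complex.ofReal_re, Complex.normSq_eq_norm_sq, mul_comm]

theorem ae_measureLaw (hA : A.IsHermitian) (ρ : Matrix m m ℂ) {M : ℝ}
    (hM : ∀ i, |hA.eigenvalues i| ≤ M) : ∀ᵐ x ∂(measureLaw hA ρ), x ∈ Set.Icc (-M) M := by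
  rw [MeasureTheory.ae_iff]
  unfold measureLaw
  rw [MeasureTheory.Measure.finsetSum_apply]
  refine Finset.sum_eq_zero fun i _ => ?_
  have h0 : MeasureTheory.Measure.dirac (hA.eigenvalues i) {x | x ∉ Set.Icc (-M) M} = 0 := by
    rw [MeasureTheory.Measure.dirac_apply, Set.indicator_of_notMem]
    simpa using abs_le.1 (hM i)
  rw [MeasureTheory.Measure.smul_apply, h0, smul_zero]

end Measurement

/-! ### Concentration of the empirical mean -/

/-- Two-sided Hoeffding bound: a variable in [-M, M] is sub-Gaussian with variance proxy M², and T
is chosen so that each tail has mass at most δ/2. The scale s is later ‖c‖₁². -/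
theorem abs_map_sum_sub_le_of_mem_Icc {ν : MeasureTheory.Measure ℝ}
    [MeasureTheory.IsProbabilityMeasure ν] {M s η δ : ℝ} {T : ℕ} (hM : 0 < M) (hs : 0 < s)
    (hη : 0 < η) (hδ : 0 < δ) (hT : 0 < T) (hν : ∀ᵐ x ∂ν, x ∈ Set.Icc (-M) M)
    (hlarge : 2 * M ^ 2 * s ^ 2 / η ^ 2 * Real.log (2 / δ) ≤ T) :
    1 - δ ≤ ((MeasureTheory.Measure.pi fun _ : Fin T => ν).map
      fun ω => s / (T : ℝ) * ∑ j, ω j).real {x | |x - s * ∫ x, x ∂ν| ≤ η} := by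
  have hT' : (0 : ℝ) < T := by exact_mod_cast hT
  set π := MeasureTheory.Measure.pi fun _ : Fin T => ν with hπ
  set c := ∫ x, x ∂ν with hc
  have hsub : ProbabilityTheory.HasSubgaussianMGF (fun x : ℝ => x - c)
      ((‖M - -M‖₊ / 2) ^ 2) ν :=
    ProbabilityTheory.hasSubgaussianMGF_of_mem_Icc (X := fun x : ℝ => x) (μ := ν)
      measurable_id.aemeasurable hν
  obtain ⟨C, hC⟩ : ∃ C : NNReal, C = (‖M - -M‖₊ / 2) ^ 2 := ⟨_, rfl⟩
  have hCM : (C : ℝ) = M ^ 2 := by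
    rw [hC]
    push_cast
    rw [Real.norm_eq_abs, abs_of_pos (by linarith)]
    ring
  rw [← hC] at hsub
  have hmp : ∀ j : Fin T, MeasureTheory.MeasurePreserving (fun ω : Fin T → ℝ => ω j) π ν :=
    fun j => MeasureTheory.measurePreserving_eval (fun _ : Fin T => ν) j
  have hsubj : ∀ j : Fin T, ProbabilityTheory.HasSubgaussianMGF (fun ω : Fin T → ℝ => ω j - c)
      C π := by
    intro j
    refine ProbabilityTheory.HasSubgaussianMGF.of_map (X := fun x : ℝ => x - c)
      (Y := fun ω : Fin T → ℝ => ω j) (hmp j).measurable.aemeasurable ?_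
    rwa [(hmp j).map_eq]
  have hindep : ProbabilityTheory.iIndepFun (fun (j : Fin T) (ω : Fin T → ℝ) => ω j - c) π :=
    ProbabilityTheory.iIndepFun_pi (μ := fun _ : Fin T => ν) (X := fun _ (x : ℝ) => x - c)
      fun _ => (measurable_id.sub_const c).aemeasurable
  have hindep' : ProbabilityTheory.iIndepFun (fun (j : Fin T) (ω : Fin T → ℝ) => -(ω j - c)) π :=
    ProbabilityTheory.iIndepFun_pi (μ := fun _ : Fin T => ν) (X := fun _ (x : ℝ) => -(x - c))
      fun _ => (measurable_id.sub_const c).neg.aemeasurable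
  have hε : 0 ≤ T * η / s := by positivity
  have htail : Real.exp (-(T * η / s) ^ 2 / (2 * ∑ _j : Fin T, M ^ 2)) ≤ δ / 2 := by
    rw [Finset.sum_const, Finset.card_univ, Fintype.card_fin, nsmul_eq_mul]
    have h1 : -(T * η / s) ^ 2 / (2 * (T * M ^ 2)) = -(T * (η ^ 2 / (2 * M ^ 2 * s ^ 2))) := by
      field_simp
    have h2 : Real.log (2 / δ) ≤ T * (η ^ 2 / (2 * M ^ 2 * s ^ 2)) := by
      calc Real.log (2 / δ) = (2 * M ^ 2 * s ^ 2 / η ^ 2 * Real.log (2 / δ)) *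
            (η ^ 2 / (2 * M ^ 2 * s ^ 2)) := by field_simp
        _ ≤ _ := by gcongr
    rw [h1, ← Real.le_log_iff_exp_le (by positivity), ← inv_div 2 δ, Real.log_inv]
    linarith
  have hup := ProbabilityTheory.HasSubgaussianMGF.measure_sum_ge_le_of_iIndepFun hindep
    (s := Finset.univ) (fun j _ => hsubj j) hε
  have hlo := ProbabilityTheory.HasSubgaussianMGF.measure_sum_ge_le_of_iIndepFun hindep'
    (s := Finset.univ) (fun j _ => (hsubj j).neg) hε
  simp only [NNReal.coe_sum, hCM] at hup hlo
  have hup' := hup.trans htail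
  have hlo' := hlo.trans htail
  have hmeas : Measurable fun ω : Fin T → ℝ => s / (T : ℝ) * ∑ j, ω j := by fun_prop
  have hset : MeasurableSet {x : ℝ | |x - s * c| ≤ η} :=
    measurableSet_le (by fun_prop) measurable_const
  rw [MeasureTheory.map_measureReal_apply hmeas hset]
  -- A deviation of the scaled mean by more than η forces the centred sum, or its negative, to be at
  -- least Tη/s.
  have hcompl : ((fun ω : Fin T → ℝ => s / (T : ℝ) * ∑ j, ω j) ⁻¹' {x | |x - s * c| ≤ η})ᶜ ⊆
      {ω | T * η / s ≤ ∑ j, (ω j - c)} ∪ {ω | T * η / s ≤ ∑ j, -(ω j - c)} := by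
    intro ω hω
    simp only [Set.mem_compl_iff, Set.mem_preimage, Set.mem_ofPred_eq, not_le] at hω
    have h1 : s / (T : ℝ) * ∑ j, ω j - s * c = s / T * ∑ j, (ω j - c) := by
      rw [Finset.sum_sub_distrib, Finset.sum_const, Finset.card_univ, Fintype.card_fin,
        nsmul_eq_mul]
      field_simp
    rw [h1, lt_abs] at hω
    simp only [Set.mem_union, Set.mem_ofPred_eq, Finset.sum_neg_distrib]
    have h2 : ∀ u : ℝ, η < s / T * u → T * η / s ≤ u := by
      intro u hu
      rw [div_le_iff₀ hs]
      have := mul_le_mul_of_nonneg_left hu.le hT'.le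
      calc T * η ≤ T * (s / T * u) := this
        _ = u * s := by field_simp
    rcases hω with h | h
    · exact Or.inl (h2 _ h)
    · exact Or.inr (h2 _ (by linarith))
  have hsum := (MeasureTheory.measureReal_mono (μ := π) hcompl).trans
    (MeasureTheory.measureReal_union_le _ _)
  rw [MeasureTheory.probReal_compl_eq_one_sub (hmeas hset)] at hsum
  linarith

/-! ### The circuit -/

section CircuitLaw

variable {N : ℕ}

/-- The state vector `(|0⟩ V₂|b⟩ + |1⟩ V₁|b⟩) / √2` at the end of the circuit. -/
noncomputable def circuitVector (V₁ V₂ : Matrix (Fin N) (Fin N) ℂ)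
    (b : EuclideanSpace ℂ (Fin N)) : EuclideanSpace ℂ (Fin 2 × Fin N) :=
  WithLp.toLp 2 fun p => ((√2)⁻¹ : ℝ) * ((![V₂, V₁] p.1) *ᵥ b.ofLp) p.2

theorem inv_sqrt_two_mul_self : (((√2)⁻¹ : ℝ) : ℂ) * (((√2)⁻¹ : ℝ) : ℂ) = 1 / 2 := by
  rw [← Complex.ofReal_mul, ← mul_inv, Real.mul_self_sqrt (by norm_num)]
  norm_num

theorem kronecker_mulVec_fin_two (X : Matrix (Fin 2) (Fin 2) ℂ) (O : Matrix (Fin N) (Fin N) ℂ)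
    (v : Fin 2 × Fin N → ℂ) (i : Fin 2) (a : Fin N) :
    ((X ⊗ₖ O) *ᵥ v) (i, a) =
      X i 0 * (O *ᵥ fun c => v (0, c)) a + X i 1 * (O *ᵥ fun c => v (1, c)) a := by
  simp only [Matrix.mulVec, dotProduct, Fintype.sum_prod_type, Fin.sum_univ_two,
    Matrix.kroneckerMap_apply, Finset.mul_sum, mul_assoc]

theorem plusState_kronecker_pureState (b : EuclideanSpace ℂ (Fin N)) :
    plusState ⊗ₖ pureState b = Matrix.vecMulVec
      (fun p : Fin 2 × Fin N => (((√2)⁻¹ : ℝ) : ℂ) * b p.2)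
      (star fun p : Fin 2 × Fin N => (((√2)⁻¹ : ℝ) : ℂ) * b p.2) := by
  ext ⟨i, a⟩ ⟨j, c⟩
  have h : plusState i j = 1 / 2 := by fin_cases i <;> fin_cases j <;> rfl
  simp only [Matrix.kroneckerMap_apply, h, pureState, Matrix.vecMulVec_apply, Pi.star_apply,
    star_mul', Complex.star_def, Complex.conj_ofReal]
  rw [← inv_sqrt_two_mul_self]
  ring

theorem circuitState_pureState (V₁ V₂ : Matrix (Fin N) (Fin N) ℂ)
    (b : EuclideanSpace ℂ (Fin N)) :
    circuitState V₁ V₂ (pureState b) =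
      Matrix.vecMulVec (circuitVector V₁ V₂ b).ofLp (star (circuitVector V₁ V₂ b).ofLp) := by
  have h : (antiControlled V₂ * controlled V₁) *ᵥ
      (fun p : Fin 2 × Fin N => (((√2)⁻¹ : ℝ) : ℂ) * b p.2) = (circuitVector V₁ V₂ b).ofLp := by
    have hs : ∀ V : Matrix (Fin N) (Fin N) ℂ,
        (V *ᵥ fun c => (((√2)⁻¹ : ℝ) : ℂ) * b c) = (((√2)⁻¹ : ℝ) : ℂ) • (V *ᵥ b.ofLp) := by
      intro V
      rw [← Matrix.mulVec_smul]
      rfl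
    rw [← Matrix.mulVec_mulVec]
    funext ⟨i, a⟩
    fin_cases i <;>
    simp [antiControlled, controlled, Matrix.add_mulVec, kronecker_mulVec_fin_two, proj0, proj1,
      circuitVector, hs, -Complex.ofReal_inv]
  rw [circuitState, plusState_kronecker_pureState, mul_assoc, ← Matrix.conjTranspose_mul,
    Matrix.mul_vecMulVec, Matrix.vecMulVec_mul, h, ← Matrix.star_mulVec, h]

theorem norm_circuitVector {V₁ V₂ : Matrix (Fin N) (Fin N) ℂ} (h₁ : star V₁ * V₁ = 1)
    (h₂ : star V₂ * V₂ = 1) {b : EuclideanSpace ℂ (Fin N)} (hb : ‖b‖ = 1) :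
    ‖circuitVector V₁ V₂ b‖ = 1 := by
  have hV : ∀ V : Matrix (Fin N) (Fin N) ℂ, star V * V = 1 →
      ∑ a, ‖(V *ᵥ b.ofLp) a‖ ^ 2 = 1 := by
    intro V hV
    have h := norm_toEuclideanCLM_of_star_mul_self hV b
    rw [hb, EuclideanSpace.norm_eq, Real.sqrt_eq_one] at h
    exact h
  have hs : ‖(((√2)⁻¹ : ℝ) : ℂ)‖ ^ 2 = 1 / 2 := by
    rw [Complex.norm_real, Real.norm_eq_abs, sq_abs, inv_pow, Real.sq_sqrt (by norm_num)]
    norm_num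
  rw [EuclideanSpace.norm_eq, Real.sqrt_eq_one, Fintype.sum_prod_type, Fin.sum_univ_two]
  simp only [circuitVector, norm_mul, mul_pow, hs, ← Finset.mul_sum, Matrix.cons_val_zero,
    Matrix.cons_val_one, hV V₁ h₁, hV V₂ h₂]
  norm_num

/-- X exchanges the two ancilla branches, so only the two cross terms survive. They are complex
conjugates because O is Hermitian. -/
theorem re_inner_circuitVector {O : Matrix (Fin N) (Fin N) ℂ} (hO : O.IsHermitian)
    (V₁ V₂ : Matrix (Fin N) (Fin N) ℂ) (b : EuclideanSpace ℂ (Fin N)) :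
    (inner ℂ (circuitVector V₁ V₂ b) (Matrix.toEuclideanCLM (n := Fin 2 × Fin N) (𝕜 := ℂ)
      (pauliX ⊗ₖ O) (circuitVector V₁ V₂ b))).re =
    (inner ℂ (Matrix.toEuclideanCLM (n := Fin N) (𝕜 := ℂ) V₂ b)
      (Matrix.toEuclideanCLM (n := Fin N) (𝕜 := ℂ) O
        (Matrix.toEuclideanCLM (n := Fin N) (𝕜 := ℂ) V₁ b))).re := by
  set T := Matrix.toEuclideanCLM (n := Fin N) (𝕜 := ℂ) with hT
  have hadj : star (T O) = T O := by
    rw [← map_star]; exact congrArg _ hO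
  have hsymm : (inner ℂ (T V₁ b) (T O (T V₂ b))).re = (inner ℂ (T V₂ b) (T O (T V₁ b))).re := by
    rw [← inner_conj_symm, Complex.conj_re, ← ContinuousLinearMap.adjoint_inner_right,
      ← ContinuousLinearMap.star_eq_adjoint, hadj]
  have hs : ∀ V : Matrix (Fin N) (Fin N) ℂ,
      (O *ᵥ fun c => (((√2)⁻¹ : ℝ) : ℂ) * (V *ᵥ b.ofLp) c) =
        (((√2)⁻¹ : ℝ) : ℂ) • (O *ᵥ (V *ᵥ b.ofLp)) := by
    intro V
    rw [← Matrix.mulVec_smul]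
    rfl
  have hin : inner ℂ (circuitVector V₁ V₂ b) (Matrix.toEuclideanCLM (n := Fin 2 × Fin N) (𝕜 := ℂ)
      (pauliX ⊗ₖ O) (circuitVector V₁ V₂ b)) =
        1 / 2 * (inner ℂ (T V₂ b) (T O (T V₁ b)) + inner ℂ (T V₁ b) (T O (T V₂ b))) := by
    simp only [PiLp.inner_apply, hT, Matrix.ofLp_toEuclideanCLM, Fintype.sum_prod_type,
      Fin.sum_univ_two, kronecker_mulVec_fin_two]
    simp only [circuitVector, Matrix.cons_val_zero, Matrix.cons_val_one, hs, pauliX,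
      ← Finset.sum_add_distrib, Finset.mul_sum]
    refine Finset.sum_congr rfl fun a _ => ?_
    rw [← inv_sqrt_two_mul_self]
    simp
    ring
  rw [hin, Complex.mul_re, Complex.add_re, hsymm]
  norm_num
  ring

/-- On the halves v₀, v₁ of an eigenvector the equation reads O v₁ = l v₀ and O v₀ = l v₁. Adding
the norm bounds gives |l|(‖v₀‖ + ‖v₁‖) ≤ ‖O‖(‖v₀‖ + ‖v₁‖). -/
theorem abs_eigenvalues_pauliX_kronecker_le {O : Matrix (Fin N) (Fin N) ℂ} (hO : O.IsHermitian)
    (i : Fin 2 × Fin N) :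
    |(isHermitian_pauliX_kronecker hO).eigenvalues i| ≤ ‖O‖ := by
  set l := (isHermitian_pauliX_kronecker hO).eigenvalues i
  set v := (isHermitian_pauliX_kronecker hO).eigenvectorBasis i with hv
  have heig : (pauliX ⊗ₖ O) *ᵥ v.ofLp = l • v.ofLp :=
    (isHermitian_pauliX_kronecker hO).mulVec_eigenvectorBasis i
  set v0 : EuclideanSpace ℂ (Fin N) := WithLp.toLp 2 fun c => v (0, c) with hv0
  set v1 : EuclideanSpace ℂ (Fin N) := WithLp.toLp 2 fun c => v (1, c) with hv1
  have h0 : Matrix.toEuclideanCLM (n := Fin N) (𝕜 := ℂ) O v1 = l • v0 := by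
    apply WithLp.ofLp_injective
    funext a
    have := congrFun heig (0, a)
    rw [kronecker_mulVec_fin_two] at this
    simpa [pauliX] using this
  have h1 : Matrix.toEuclideanCLM (n := Fin N) (𝕜 := ℂ) O v0 = l • v1 := by
    apply WithLp.ofLp_injective
    funext a
    have := congrFun heig (1, a)
    rw [kronecker_mulVec_fin_two] at this
    simpa [pauliX] using this
  have hn0 := (Matrix.toEuclideanCLM (n := Fin N) (𝕜 := ℂ) O).le_opNorm v1
  have hn1 := (Matrix.toEuclideanCLM (n := Fin N) (𝕜 := ℂ) O).le_opNorm v0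
  rw [h0, norm_smul, Matrix.l2_opNorm_toEuclideanCLM, Real.norm_eq_abs] at hn0
  rw [h1, norm_smul, Matrix.l2_opNorm_toEuclideanCLM, Real.norm_eq_abs] at hn1
  have hpos : 0 < ‖v0‖ + ‖v1‖ := by
    by_contra hneg
    have hz0 : v0 = 0 := norm_le_zero_iff.1 (by linarith [norm_nonneg v1])
    have hz1 : v1 = 0 := norm_le_zero_iff.1 (by linarith [norm_nonneg v0])
    have hvz : v = 0 := by
      apply WithLp.ofLp_injective
      funext ⟨j, a⟩
      fin_cases j
      · exact congrFun (congrArg WithLp.ofLp hz0) a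
      · exact congrFun (congrArg WithLp.ofLp hz1) a
    have hone : ‖v‖ = 1 := (isHermitian_pauliX_kronecker hO).eigenvectorBasis.orthonormal.1 i
    rw [hvz, norm_zero] at hone
    exact zero_ne_one hone
  refine le_of_mul_le_mul_right ?_ hpos
  linarith

/-! ### The law of one run -/

variable {ι : Type*} [Fintype ι] {O : Matrix (Fin N) (Fin N) ℂ} {c : ι → ℝ}
  {U : ι → Matrix (Fin N) (Fin N) ℂ} {b : EuclideanSpace ℂ (Fin N)}

theorem isProbabilityMeasure_runLaw (hO : O.IsHermitian) (hc : ∀ p, 0 ≤ c p) (hsum : 0 < ∑ p, c p)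
    (hU : ∀ p, star (U p) * U p = 1) (hb : ‖b‖ = 1) :
    MeasureTheory.IsProbabilityMeasure (runLaw hO c U (pureState b)) := by
  constructor
  have h1 : ∀ p q, measureLaw (isHermitian_pauliX_kronecker hO)
      (circuitState (U p) (U q) (pureState b)) Set.univ = 1 := by
    intro p q
    have := isProbabilityMeasure_measureLaw (isHermitian_pauliX_kronecker hO)
      (norm_circuitVector (hU p) (hU q) hb)
    rw [circuitState_pureState]
    exact MeasureTheory.measure_univ
  unfold runLaw
  simp only [MeasureTheory.Measure.finsetSum_apply, MeasureTheory.Measure.smul_apply, h1,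
    smul_eq_mul, mul_one]
  have hnn : ∀ p q, 0 ≤ (c p / ∑ r, c r) * (c q / ∑ r, c r) := fun p q =>
    mul_nonneg (div_nonneg (hc p) hsum.le) (div_nonneg (hc q) hsum.le)
  simp only [← ENNReal.ofReal_sum_of_nonneg fun q _ => hnn _ q]
  rw [← ENNReal.ofReal_sum_of_nonneg fun p _ => Finset.sum_nonneg fun q _ => hnn p q]
  simp only [← Finset.mul_sum, ← Finset.sum_mul, ← Finset.sum_div]
  rw [div_self hsum.ne']
  simp

theorem ae_runLaw (hO : O.IsHermitian) :
    ∀ᵐ x ∂(runLaw hO c U (pureState b)), x ∈ Set.Icc (-‖O‖) ‖O‖ := by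
  rw [MeasureTheory.ae_iff]
  unfold runLaw
  simp only [MeasureTheory.Measure.finsetSum_apply, MeasureTheory.Measure.smul_apply]
  refine Finset.sum_eq_zero fun p _ => Finset.sum_eq_zero fun q _ => ?_
  have h := ae_measureLaw (isHermitian_pauliX_kronecker hO)
    (circuitState (U p) (U q) (pureState b)) (abs_eigenvalues_pauliX_kronecker_le hO)
  rw [MeasureTheory.ae_iff] at h
  rw [h, smul_zero]

/-- Unbiasedness: sampling p and q independently produces the weights c_p c_q/‖c‖₁², which are
exactly those of the sesquilinear expansion of ⟨gb, O gb⟩ with g = ∑ c_p U_p. -/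
theorem integral_runLaw (hO : O.IsHermitian) (hc : ∀ p, 0 ≤ c p) (hsum : 0 < ∑ p, c p)
    (hU : ∀ p, star (U p) * U p = 1) (hb : ‖b‖ = 1) :
    (∑ p, c p) ^ 2 * ∫ x, x ∂(runLaw hO c U (pureState b)) =
      expectation O (Matrix.toEuclideanCLM (n := Fin N) (𝕜 := ℂ) (∑ p, (c p : ℂ) • U p) b) := by
  set S := ∑ p, c p with hS
  have hint : ∀ p q, MeasureTheory.Integrable (fun x : ℝ => x)
      (measureLaw (isHermitian_pauliX_kronecker hO)
        (circuitState (U p) (U q) (pureState b))) := by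
    intro p q
    have := isProbabilityMeasure_measureLaw (isHermitian_pauliX_kronecker hO)
      (norm_circuitVector (hU p) (hU q) hb)
    rw [circuitState_pureState]
    exact MeasureTheory.Integrable.of_mem_Icc _ _ measurable_id.aemeasurable
      (ae_measureLaw (isHermitian_pauliX_kronecker hO) _ (abs_eigenvalues_pauliX_kronecker_le hO))
  have hint' : ∀ p q, MeasureTheory.Integrable (fun x : ℝ => x)
      (ENNReal.ofReal ((c p / S) * (c q / S)) • measureLaw (isHermitian_pauliX_kronecker hO)
        (circuitState (U p) (U q) (pureState b))) := fun p q =>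
    (hint p q).smul_measure ENNReal.ofReal_ne_top
  have hnn : ∀ p q, 0 ≤ (c p / S) * (c q / S) := fun p q =>
    mul_nonneg (div_nonneg (hc p) hsum.le) (div_nonneg (hc q) hsum.le)
  unfold runLaw
  rw [← hS, MeasureTheory.integral_finsetSum_measure fun p _ =>
    MeasureTheory.integrable_finsetSum_measure.2 fun q _ => hint' p q]
  have hlin : Matrix.toEuclideanCLM (n := Fin N) (𝕜 := ℂ) (∑ p, (c p : ℂ) • U p) b =
      ∑ p, (c p : ℂ) • Matrix.toEuclideanCLM (n := Fin N) (𝕜 := ℂ) (U p) b := by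
    rw [map_sum, sum_apply]
    refine Finset.sum_congr rfl fun p _ => ?_
    rw [map_smul]
    rfl
  rw [expectation, hlin, map_sum, inner_sum, Complex.re_sum, Finset.mul_sum]
  refine Finset.sum_congr rfl fun p _ => ?_
  rw [MeasureTheory.integral_finsetSum_measure fun q _ => hint' p q, sum_inner, Complex.re_sum,
    Finset.mul_sum]
  refine Finset.sum_congr rfl fun q _ => ?_
  rw [MeasureTheory.integral_smul_measure, ENNReal.toReal_ofReal (hnn p q),
    circuitState_pureState, integral_measureLaw, re_inner_circuitVector hO, map_smul, inner_smul_left, inner_smul_right, Complex.conj_ofReal, Complex.re_ofReal_mul,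
    Complex.re_ofReal_mul, smul_eq_mul]
  field_simp

end CircuitLaw

/-! ### The coefficients and the evolution times -/

theorem sum_Icc_pow_natAbs_le {q : ℝ} (hq0 : 0 ≤ q) (hq1 : q < 1) (K : ℕ) :
    ∑ k ∈ Finset.Icc (-(K : ℤ)) K, q ^ k.natAbs ≤ 2 / (1 - q) := by
  have h : HasSum (fun k : ℤ => q ^ k.natAbs) ((1 - q)⁻¹ + q * (1 - q)⁻¹) := by
    refine HasSum.of_nat_of_neg_add_one ?_ ?_
    · simpa using hasSum_geometric_of_lt_one hq0 hq1
    · refine (hasSum_congr_of_eq fun n => ?_).mpr ((hasSum_geometric_of_lt_one hq0 hq1).mul_left q)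
      have : (-((n : ℤ) + 1)).natAbs = n + 1 := by omega
      rw [this, pow_succ']
  refine (sum_le_hasSum _ (fun k _ => pow_nonneg hq0 _) h).trans ?_
  have h1 : 0 < (1 - q)⁻¹ := inv_pos.2 (by linarith)
  rw [div_eq_mul_inv]
  nlinarith

/-- A Riemann sum for the finite integral ∫ |z| e^{-z²/2} dz, bounded uniformly in K by comparison
with the geometric series of ratio e^{-d}. -/
theorem sum_Icc_gaussian_le {d : ℝ} (hd : 0 < d) (K : ℕ) :
    ∑ k ∈ Finset.Icc (-(K : ℤ)) K, d * (|(k : ℝ) * d| * Real.exp (-(k * d) ^ 2 / 2)) ≤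
      6 * (1 + d) := by
  set q := Real.exp (-d) with hq
  have hq0 : 0 < q := Real.exp_pos _
  have hqd : q * d ≤ 1 - q := by
    have h1 := Real.add_one_le_exp d
    have h2 : q * Real.exp d = 1 := by rw [hq, ← Real.exp_add]; simp
    nlinarith
  have hq1 : q < 1 := by nlinarith [mul_pos hq0 hd]
  have hterm : ∀ k : ℤ, |(k : ℝ) * d| * Real.exp (-(k * d) ^ 2 / 2) ≤
      Real.exp 1 * q ^ k.natAbs := by
    intro k
    have h := self_mul_exp_neg_le ((k : ℝ) * d)
    rw [abs_mul, Real.abs_exp] at h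
    refine h.trans ?_
    have hkabs : |(k : ℝ)| = k.natAbs := by rw [Nat.cast_natAbs]; push_cast; rfl
    rw [hq, ← Real.exp_nat_mul, ← Real.exp_add, Real.exp_le_exp, ← hkabs]
    have h3 : |(k : ℝ) * d| = |(k : ℝ)| * d := by rw [abs_mul, abs_of_pos hd]
    -- The square is u²/4 - |u| + 1 ≥ 0 for u = kd, hence -u²/4 ≤ 1 - |u|.
    nlinarith [sq_nonneg (|(k : ℝ) * d| / 2 - 1), sq_abs ((k : ℝ) * d)]
  calc _ ≤ ∑ k ∈ Finset.Icc (-(K : ℤ)) K, d * (Real.exp 1 * q ^ k.natAbs) :=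
        Finset.sum_le_sum fun k _ => mul_le_mul_of_nonneg_left (hterm k) hd.le
    _ = d * Real.exp 1 * ∑ k ∈ Finset.Icc (-(K : ℤ)) K, q ^ k.natAbs := by
        rw [Finset.mul_sum]
        exact Finset.sum_congr rfl fun k _ => by ring
    _ ≤ d * Real.exp 1 * (2 / (1 - q)) := by
        gcongr
        exact sum_Icc_pow_natAbs_le hq0.le hq1 K
    _ = 2 * Real.exp 1 * (d / (1 - q)) := by ring
    _ ≤ 2 * Real.exp 1 * (1 + d) := by
        gcongr
        rw [div_le_iff₀ (by linarith)]
        nlinarith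
    _ ≤ 6 * (1 + d) := by
        gcongr
        linarith [Real.exp_one_lt_d9]

namespace FourierParams

variable {P : FourierParams}

theorem coeff_nonneg (hy : 0 ≤ P.Δy) (hz : 0 ≤ P.Δz) (p : P.Index) : 0 ≤ P.coeff p := by
  unfold coeff
  positivity

theorem sum_coeff_le (hy : 0 < P.Δy) (hz : 0 < P.Δz) :
    ∑ p, P.coeff p ≤ P.J * P.Δy * (6 * (1 + P.Δz)) := by
  have hsq1 : (1 : ℝ) ≤ √(2 * Real.pi) := by
    rw [Real.one_le_sqrt]; linarith [Real.pi_gt_three]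
  have h : ∀ p : P.Index, P.coeff p ≤ P.Δy *
      (P.Δz * (|((p.2 : ℤ) : ℝ) * P.Δz| * Real.exp (-(((p.2 : ℤ) : ℝ) * P.Δz) ^ 2 / 2))) := by
    intro p
    refine (div_le_self ?_ hsq1).trans_eq ?_
    · positivity
    · simp only [z]; ring
  refine (Finset.sum_le_sum fun p _ => h p).trans ?_
  have hsum : ∀ f : ℤ → ℝ, ∑ p : P.Index, P.Δy * f p.2 =
      P.J * P.Δy * ∑ k ∈ Finset.Icc (-(P.K : ℤ)) (P.K : ℤ), f k := by
    intro f
    rw [Fintype.sum_prod_type]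
    simp only [Finset.sum_const, Finset.card_univ, Fintype.card_fin, nsmul_eq_mul,
      ← Finset.mul_sum]
    rw [Finset.sum_coe_sort (Finset.Icc (-(P.K : ℤ)) (P.K : ℤ)) f, mul_assoc]
  rw [hsum fun k => P.Δz * (|(k : ℝ) * P.Δz| * Real.exp (-((k : ℝ) * P.Δz) ^ 2 / 2))]
  gcongr
  exact sum_Icc_gaussian_le hz P.K

theorem maxRunTime_le (hy : 0 < P.Δy) (hz : 0 < P.Δz) :
    P.maxRunTime ≤ 2 * ((P.J * P.Δy) * (P.K * P.Δz)) := by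
  have h : ∀ p : P.Index, |P.time p| ≤ (P.J * P.Δy) * (P.K * P.Δz) := by
    intro p
    have h1 : ((p.1 : ℕ) : ℝ) ≤ P.J := by exact_mod_cast p.1.2.le
    have h2 : |((p.2 : ℤ) : ℝ)| ≤ P.K := by
      have h3 := Finset.mem_Icc.1 p.2.2
      have h4 : |(p.2 : ℤ)| ≤ P.K := abs_le.2 h3
      exact_mod_cast h4
    rw [time, y, z, abs_mul, abs_mul, abs_mul, abs_of_pos hy, abs_of_pos hz, Nat.abs_cast]
    gcongr
  -- Nonnegativity of the bound covers the empty index set `J = 0`, where the real supremum is 0.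
  refine Real.iSup_le (fun pq => ?_) (by positivity)
  linarith [h pq.1, h pq.2]

namespace IsTheta

variable {A κ γ : ℝ}

theorem Δy_pos (hP : P.IsTheta A κ γ) (hA : 1 ≤ A) (hγ : 0 < γ)
    (hL : 0 < Real.log (κ / γ)) : 0 < P.Δy :=
  lt_of_lt_of_le (by have := Real.sqrt_pos.2 hL; positivity) hP.Δy_lower

theorem Δz_pos (hP : P.IsTheta A κ γ) (hA : 1 ≤ A) (hκ : 0 < κ)
    (hL : 0 < Real.log (κ / γ)) : 0 < P.Δz :=
  lt_of_lt_of_le (by have := Real.sqrt_pos.2 hL; positivity) hP.Δz_lower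

theorem J_mul_Δy_le (hP : P.IsTheta A κ γ) (hA : 1 ≤ A) (hκ : 0 < κ) (hγ : 0 < γ)
    (hL : 0 < Real.log (κ / γ)) : P.J * P.Δy ≤ A ^ 2 * (κ * √(Real.log (κ / γ))) := by
  have hs := Real.sqrt_pos.2 hL
  have hss := Real.mul_self_sqrt hL.le
  have hy := hP.Δy_pos hA hγ hL
  calc P.J * P.Δy ≤ A * (κ / γ * Real.log (κ / γ)) * (A * (γ / √(Real.log (κ / γ)))) :=
        mul_le_mul hP.J_upper hP.Δy_upper hy.le (by positivity)
    _ = A ^ 2 * (κ * (Real.log (κ / γ) / √(Real.log (κ / γ)))) := by field_simp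
    _ = _ := by rw [Real.div_sqrt]

theorem K_mul_Δz_le (hP : P.IsTheta A κ γ) (hA : 1 ≤ A) (hκ : 0 < κ)
    (hL : 0 < Real.log (κ / γ)) : P.K * P.Δz ≤ A ^ 2 * √(Real.log (κ / γ)) := by
  have hs := Real.sqrt_pos.2 hL
  have hz := hP.Δz_pos hA hκ hL
  calc P.K * P.Δz ≤ A * (κ * Real.log (κ / γ)) * (A * (κ * √(Real.log (κ / γ)))⁻¹) :=
        mul_le_mul hP.K_upper hP.Δz_upper hz.le (by positivity)
    _ = A ^ 2 * (Real.log (κ / γ) / √(Real.log (κ / γ))) := by field_simp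
    _ = _ := by rw [Real.div_sqrt]

/-- The sum over k is O(1), so ‖c‖₁ has the order of Y, namely κ√L. The constant is 20736 = 12⁴,
with 12 = 6 · 2 from 1 + Δz ≤ 2A. -/
theorem sum_coeff_pow_four_le (hP : P.IsTheta A κ γ) (hA : 1 ≤ A) (hκ : 1 ≤ κ) (hγ : 0 < γ)
    (hL : 1 ≤ Real.log (κ / γ)) :
    (∑ p, P.coeff p) ^ 4 ≤ 20736 * A ^ 12 * κ ^ 4 * Real.log (κ / γ) ^ 2 := by
  have hL0 : 0 < Real.log (κ / γ) := by linarith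
  have hκ0 : 0 < κ := by linarith
  have hy := hP.Δy_pos hA hγ hL0
  have hz := hP.Δz_pos hA hκ0 hL0
  have hs1 : 1 ≤ √(Real.log (κ / γ)) := Real.one_le_sqrt.2 hL
  have hzA : P.Δz ≤ A := by
    refine hP.Δz_upper.trans ?_
    have : (κ * √(Real.log (κ / γ)))⁻¹ ≤ 1 := inv_le_one_of_one_le₀ (by nlinarith)
    nlinarith
  have h1 : ∑ p, P.coeff p ≤ 12 * A ^ 3 * (κ * √(Real.log (κ / γ))) := by
    calc ∑ p, P.coeff p ≤ P.J * P.Δy * (6 * (1 + P.Δz)) := sum_coeff_le hy hz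
      _ ≤ A ^ 2 * (κ * √(Real.log (κ / γ))) * (6 * (A + A)) := by
          refine mul_le_mul (hP.J_mul_Δy_le hA hκ0 hγ hL0) ?_ (by positivity) (by positivity)
          gcongr
      _ = _ := by ring
  have h0 : 0 ≤ ∑ p, P.coeff p := Finset.sum_nonneg fun p _ => coeff_nonneg hy.le hz.le p
  calc (∑ p, P.coeff p) ^ 4 ≤ (12 * A ^ 3 * (κ * √(Real.log (κ / γ)))) ^ 4 := by gcongr
    _ = 20736 * A ^ 12 * κ ^ 4 * (√(Real.log (κ / γ)) ^ 2) ^ 2 := by ring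
    _ = _ := by rw [Real.sq_sqrt hL0.le]

end IsTheta

end FourierParams

/-! ### The ratio of the two estimates -/

section Ratio

variable {N : ℕ} {O : Matrix (Fin N) (Fin N) ℂ}

theorem abs_expectation_sub_le (u v : EuclideanSpace ℂ (Fin N)) :
    |expectation O u - expectation O v| ≤ ‖O‖ * (‖u‖ + ‖v‖) * ‖u - v‖ := by
  set T := Matrix.toEuclideanCLM (n := Fin N) (𝕜 := ℂ) O with hT
  have hTn : ∀ x, ‖T x‖ ≤ ‖O‖ * ‖x‖ := fun x => T.le_opNorm x
  have h1 : inner ℂ u (T u) - inner ℂ v (T v) = inner ℂ u (T (u - v)) + inner ℂ (u - v) (T v) := by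
    rw [map_sub, inner_sub_right, inner_sub_left]; ring
  have h2 : expectation O u - expectation O v =
      (inner ℂ u (T (u - v)) + inner ℂ (u - v) (T v)).re := by
    rw [← h1, Complex.sub_re]; rfl
  rw [h2]
  calc _ ≤ ‖inner ℂ u (T (u - v)) + inner ℂ (u - v) (T v)‖ := Complex.abs_re_le_norm _
    _ ≤ ‖u‖ * (‖O‖ * ‖u - v‖) + ‖u - v‖ * (‖O‖ * ‖v‖) := by
        refine (norm_add_le _ _).trans (add_le_add ?_ ?_)
        · exact (norm_inner_le_norm _ _).trans (by gcongr; exact hTn _)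
        · exact (norm_inner_le_norm _ _).trans (by gcongr; exact hTn _)
    _ = _ := by ring

theorem expectation_smul (r : ℝ) (v : EuclideanSpace ℂ (Fin N)) :
    expectation O ((r : ℂ) • v) = r ^ 2 * expectation O v := by
  rw [expectation, expectation, map_smul, inner_smul_left, inner_smul_right, Complex.conj_ofReal,
    Complex.re_ofReal_mul, Complex.re_ofReal_mul]
  ring

theorem expectation_one (v : EuclideanSpace ℂ (Fin N)) :
    expectation (1 : Matrix (Fin N) (Fin N) ℂ) v = ‖v‖ ^ 2 := by
  rw [expectation, map_one]
  exact inner_self_eq_norm_sq (𝕜 := ℂ) v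

/-- The vector v is compared with ‖v‖u, where u = w/‖w‖, rather than with w. Every error is then of
order ε(1 + ‖v‖), while the denominator is about ‖v‖², so no upper bound on ‖w‖ is needed. -/
theorem ratio_sub_expectation_le {v w : EuclideanSpace ℂ (Fin N)} {ε γ μ l : ℝ} (hε : 0 < ε)
    (hγ0 : 0 ≤ γ) (hγ : γ ≤ 1 / 18) (hεγ : ‖O‖ * γ = ε / 18) (hw : 1 ≤ ‖w‖) (hvw : ‖w - v‖ ≤ γ)
    (hμ : |μ - expectation O v| ≤ ε / 18) (hl : |l - ‖v‖ ^ 2| ≤ γ) :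
    0 < l ∧ |μ / l - expectation O (((‖w‖⁻¹ : ℝ) : ℂ) • w)| ≤ ε := by
  set e := expectation O (((‖w‖⁻¹ : ℝ) : ℂ) • w) with he
  set n := ‖v‖ with hn
  have hw0 : ‖w‖ ≠ 0 := by linarith
  have hunit : ‖((‖w‖⁻¹ : ℝ) : ℂ) • w‖ = 1 := by
    rw [norm_smul, Complex.norm_real, norm_inv, norm_norm, inv_mul_cancel₀ hw0]
  have hn1 : 17 / 18 ≤ n := by
    have := norm_sub_norm_le w v
    linarith
  have hn2 : 17 / 18 * n ≤ n ^ 2 := by nlinarith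
  have hl' := abs_le.1 hl
  have hl0 : 0 < l := by nlinarith
  refine ⟨hl0, ?_⟩
  have hebound : |e| ≤ ‖O‖ := by
    have h := abs_expectation_sub_le (O := O) (((‖w‖⁻¹ : ℝ) : ℂ) • w) 0
    have h0 : expectation O 0 = 0 := by simp [expectation]
    rwa [h0, sub_zero, sub_zero, norm_zero, add_zero, hunit, mul_one, mul_one] at h
  have hdiff : |expectation O v - n ^ 2 * e| ≤ 4 * n * (ε / 18) := by
    set u := ((‖w‖⁻¹ : ℝ) : ℂ) • w with hu
    have hwu : w = (‖w‖ : ℂ) • u := by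
      rw [hu, smul_smul, ← Complex.ofReal_mul, mul_inv_cancel₀ hw0, Complex.ofReal_one, one_smul]
    have hdist : ‖w - (n : ℂ) • u‖ ≤ γ := by
      have h : w - (n : ℂ) • u = ((‖w‖ - n : ℝ) : ℂ) • u := by
        rw [Complex.ofReal_sub, sub_smul, ← hwu]
      rw [h, norm_smul, hunit, mul_one, Complex.norm_real]
      exact (abs_norm_sub_norm_le w v).trans hvw
    have hdist2 : ‖v - (n : ℂ) • u‖ ≤ 2 * γ := by
      have h := norm_sub_le_norm_sub_add_norm_sub v w ((n : ℂ) • u)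
      rw [norm_sub_rev v w] at h
      linarith
    have hnu : ‖(n : ℂ) • u‖ = n := by
      rw [norm_smul, hunit, mul_one, Complex.norm_real, Real.norm_eq_abs, abs_of_nonneg (by linarith)]
    have h := abs_expectation_sub_le (O := O) v ((n : ℂ) • u)
    rw [expectation_smul, hnu, ← he] at h
    calc _ ≤ ‖O‖ * (n + n) * ‖v - (n : ℂ) • u‖ := h
      _ ≤ ‖O‖ * (n + n) * (2 * γ) := by gcongr
      _ = 4 * n * (‖O‖ * γ) := by ring
      _ = _ := by rw [hεγ]
  have hle : |(n ^ 2 - l) * e| ≤ ε / 18 := by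
    rw [abs_mul, abs_sub_comm, ← hεγ, mul_comm ‖O‖]
    gcongr
  have hsum : |μ - l * e| ≤ ε / 18 * (2 + 4 * n) := by
    have : μ - l * e = (μ - expectation O v) + (expectation O v - n ^ 2 * e) + (n ^ 2 - l) * e := by
      ring
    rw [this]
    refine (abs_add_three _ _ _).trans ?_
    linarith
  have : μ / l - e = (μ - l * e) / l := by field_simp
  rw [this, abs_div, abs_of_pos hl0, div_le_iff₀ hl0]
  refine hsum.trans ?_
  -- This is where the constant 18 enters: l ≥ n² - 1/18 ≥ (17n - 1)/18, and 13n ≥ 3.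
  have : 1 / 18 * (2 + 4 * n) ≤ l := by nlinarith
  nlinarith

end Ratio

/-! ### The algorithm -/

theorem one_sub_le_expectationObservable {N : ℕ} {ι : Type*} [Fintype ι]
    {O : Matrix (Fin N) (Fin N) ℂ} (hO : O.IsHermitian) {c : ι → ℝ}
    {U : ι → Matrix (Fin N) (Fin N) ℂ} {b : EuclideanSpace ℂ (Fin N)} {η δ : ℝ} {T : ℕ}
    (hO0 : 0 < ‖O‖) (hc : ∀ p, 0 ≤ c p) (hsum : 0 < ∑ p, c p)
    (hU : ∀ p, star (U p) * U p = 1) (hb : ‖b‖ = 1) (hη : 0 < η) (hδ : 0 < δ) (hT : 0 < T)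
    (hlarge : 2 * ‖O‖ ^ 2 * (∑ p, c p) ^ 4 / η ^ 2 * Real.log (2 / δ) ≤ T) :
    1 - δ ≤ (expectationObservable hO c U (pureState b) T).real
      {x | |x - expectation O (Matrix.toEuclideanCLM (n := Fin N) (𝕜 := ℂ)
        (∑ p, (c p : ℂ) • U p) b)| ≤ η} := by
  have := isProbabilityMeasure_runLaw hO hc hsum hU hb
  rw [← integral_runLaw hO hc hsum hU hb]
  refine abs_map_sum_sub_le_of_mem_Icc hO0 (pow_pos hsum 2) hη hδ hT (ae_runLaw hO) ?_
  rwa [← pow_mul]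

theorem isProbabilityMeasure_expectationObservable {N : ℕ} {ι : Type*} [Fintype ι]
    {O : Matrix (Fin N) (Fin N) ℂ} (hO : O.IsHermitian) {c : ι → ℝ}
    {U : ι → Matrix (Fin N) (Fin N) ℂ} {b : EuclideanSpace ℂ (Fin N)} (T : ℕ)
    (hc : ∀ p, 0 ≤ c p) (hsum : 0 < ∑ p, c p)
    (hU : ∀ p, star (U p) * U p = 1) (hb : ‖b‖ = 1) :
    MeasureTheory.IsProbabilityMeasure (expectationObservable hO c U (pureState b) T) := by
  have := isProbabilityMeasure_runLaw hO hc hsum hU hb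
  exact MeasureTheory.Measure.isProbabilityMeasure_map
    (Measurable.aemeasurable (by fun_prop))

/-- Replaces log(κ/γ) = log(18x), with x = ‖O‖κ/ε, by the logarithm log(2x) of the statement, using
18x ≤ 32x⁵. -/
theorem log_eighteen_mul_le {x : ℝ} (hx : 1 ≤ x) :
    Real.log (18 * x) ≤ 5 * Real.log (2 * x) := by
  have h1 : Real.log (18 * x) ≤ Real.log ((2 * x) ^ 5) := by
    apply Real.log_le_log (by positivity)
    have : x ≤ x ^ 5 := le_self_pow₀ hx (by norm_num)
    nlinarith
  rwa [Real.log_pow] at h1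

theorem one_le_log_eighteen_mul {x : ℝ} (hx : 1 ≤ x) : 1 ≤ Real.log (18 * x) := by
  rw [Real.le_log_iff_exp_le (by positivity)]
  linarith [Real.exp_one_lt_d9]

theorem one_sub_sq_le_singleAncillaLCU {N : ℕ} {H : Matrix (Fin N) (Fin N) ℂ}
    (hH : H.IsHermitian) {O : Matrix (Fin N) (Fin N) ℂ} (hO : O.IsHermitian)
    {b : EuclideanSpace ℂ (Fin N)} {κ ε δ γ : ℝ} {P : FourierParams} {T : ℕ} (hκ : 1 ≤ κ)
    (hspec : ∀ i, hH.eigenvalues i ≠ 0 → hH.eigenvalues i ∈ invDomain κ) (hb : ‖b‖ = 1)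
    (hrange : ∃ v, Matrix.toEuclideanCLM (n := Fin N) (𝕜 := ℂ) H v = b)
    (hε : 0 < ε) (hδ : 0 < δ) (hδ1 : δ < 1) (hO0 : 0 < ‖O‖) (hγ0 : 0 < γ) (hγ : γ ≤ 1 / 18)
    (hεγ : ‖O‖ * γ = ε / 18) (hy : 0 ≤ P.Δy) (hz : 0 ≤ P.Δz)
    (happrox : ‖hermInv hH - P.gMat H‖ ≤ γ)
    (hT0 : 0 < T) (hT : 2 * (∑ p, P.coeff p) ^ 4 / γ ^ 2 * Real.log (2 / δ) ≤ T) :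
    (1 - δ) ^ 2 ≤ (singleAncillaLCU hO P.coeff (P.unitary H) (pureState b) T).real
      {out : ℝ × ℝ | 0 < out.2 ∧
        |out.1 / out.2 - expectation O (solutionState hH b)| ≤ ε} := by
  set S := ∑ p, P.coeff p with hS
  have hc := FourierParams.coeff_nonneg hy hz
  have hU := P.star_unitary_mul_self hH
  set w := Matrix.toEuclideanCLM (n := Fin N) (𝕜 := ℂ) (hermInv hH) b with hw
  set v := Matrix.toEuclideanCLM (n := Fin N) (𝕜 := ℂ) (P.gMat H) b with hv
  have hw1 : 1 ≤ ‖w‖ := one_le_norm_hermInv hH hκ hspec hb hrange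
  have hvw : ‖w - v‖ ≤ γ := by
    have h1 : w - v = Matrix.toEuclideanCLM (n := Fin N) (𝕜 := ℂ) (hermInv hH - P.gMat H) b := by
      rw [map_sub]; rfl
    have h2 := (Matrix.toEuclideanCLM (n := Fin N) (𝕜 := ℂ)
      (hermInv hH - P.gMat H)).le_opNorm b
    rw [hb, mul_one, Matrix.l2_opNorm_toEuclideanCLM] at h2
    rw [h1]
    exact h2.trans happrox
  -- If all coefficients vanished, g(H) would be 0, contradicting ‖w - v‖ ≤ γ < 1 ≤ ‖w‖.
  have hsum : 0 < S := by
    refine (Finset.sum_nonneg fun p _ => hc p).lt_of_ne fun h0 => ?_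
    have hc0 : ∀ p, P.coeff p = 0 := fun p =>
      (Finset.sum_eq_zero_iff_of_nonneg fun p _ => hc p).1 h0.symm p (Finset.mem_univ p)
    have hg0 : P.gMat H = 0 := by
      rw [← P.sum_coeff_unitary H]
      exact Finset.sum_eq_zero fun p _ => by rw [hc0 p, Complex.ofReal_zero, zero_smul]
    have hv0 : v = 0 := by rw [hv, hg0, map_zero]; rfl
    rw [hv0, sub_zero] at hvw
    linarith
  have hone : ‖(1 : Matrix (Fin N) (Fin N) ℂ)‖ = 1 := by
    have : Nonempty (Fin N) := by
      by_contra hne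
      rw [not_nonempty_iff] at hne
      rw [Subsingleton.elim b 0, norm_zero] at hb
      exact zero_ne_one hb
    exact CStarRing.norm_one
  -- Tolerances ε/18 = ‖O‖γ for O and γ for the identity lead to the same requirement on T.
  have hμ := one_sub_le_expectationObservable (η := ε / 18) hO hO0 hc hsum hU hb (by positivity)
    hδ hT0 (by
      refine le_trans (le_of_eq ?_) hT
      rw [← hεγ, ← hS]
      field_simp)
  have hl := one_sub_le_expectationObservable (η := γ)
    (Matrix.isHermitian_one : (1 : Matrix (Fin N) (Fin N) ℂ).IsHermitian) (by rw [hone]; norm_num)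
    hc hsum hU hb hγ0 hδ hT0 (by rwa [hone, one_pow, mul_one])
  rw [P.sum_coeff_unitary H, ← hv] at hμ hl
  rw [expectation_one] at hl
  have hp1 := isProbabilityMeasure_expectationObservable hO T hc hsum hU hb
  have hp2 := isProbabilityMeasure_expectationObservable
    (Matrix.isHermitian_one : (1 : Matrix (Fin N) (Fin N) ℂ).IsHermitian) T hc hsum hU hb
  have hsub : {x : ℝ | |x - expectation O v| ≤ ε / 18} ×ˢ {x : ℝ | |x - ‖v‖ ^ 2| ≤ γ} ⊆
      {out : ℝ × ℝ | 0 < out.2 ∧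
        |out.1 / out.2 - expectation O (solutionState hH b)| ≤ ε} := by
    rintro ⟨μ, l⟩ ⟨h1, h2⟩
    exact ratio_sub_expectation_le hε hγ0.le hγ hεγ hw1 hvw h1 h2
  unfold singleAncillaLCU
  refine le_trans ?_ (MeasureTheory.measureReal_mono hsub)
  rw [MeasureTheory.measureReal_prod_prod, sq]
  exact mul_le_mul hμ hl (by linarith) MeasureTheory.measureReal_nonneg

end SingleAncilla

theorem mainTheorem8 :
    -- The Fourier series approximates the inverse, for suitable parameters of the stated orders.
    (∃ A : ℝ, 1 ≤ A ∧ ∀ κ γ : ℝ, 1 ≤ κ → 0 < γ → γ ≤ 1 / 2 →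
      ∃ P : SingleAncilla.FourierParams, P.IsTheta A κ γ ∧
        (∀ x ∈ SingleAncilla.invDomain κ, ‖((1 / x : ℝ) : ℂ) - P.g x‖ ≤ γ) ∧
        ∀ (N : ℕ) (H : Matrix (Fin N) (Fin N) ℂ) (hH : H.IsHermitian),
          (∀ i, hH.eigenvalues i ≠ 0 → hH.eigenvalues i ∈ SingleAncilla.invDomain κ) →
          ‖SingleAncilla.hermInv hH - P.gMat H‖ ≤ γ) ∧
    -- For all parameters of these orders, with an error of at most `γ = ε / (18 ‖O‖)`, the
    -- algorithm succeeds.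
    (∀ A : ℝ, 1 ≤ A → ∃ C : ℝ, 0 < C ∧
      ∀ (N : ℕ) (H : Matrix (Fin N) (Fin N) ℂ) (hH : H.IsHermitian)
        (O : Matrix (Fin N) (Fin N) ℂ) (hO : O.IsHermitian)
        (b : EuclideanSpace ℂ (Fin N)) (κ ε δ γ : ℝ) (P : SingleAncilla.FourierParams),
        1 ≤ κ →
        (∀ i, hH.eigenvalues i ≠ 0 → hH.eigenvalues i ∈ SingleAncilla.invDomain κ) →
        ‖b‖ = 1 →
        (∃ v, Matrix.toEuclideanCLM (n := Fin N) (𝕜 := ℂ) H v = b) →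
        0 < ε → ε < 1 → 0 < δ → δ < 1 → ε ≤ ‖O‖ →
        γ = ε / (18 * ‖O‖) →
        P.IsTheta A κ γ →
        ‖SingleAncilla.hermInv hH - P.gMat H‖ ≤ γ →
        (∀ T : ℕ,
          C * (‖O‖ ^ 2 * κ ^ 4 * Real.log (2 * ‖O‖ * κ / ε) ^ 2 * Real.log (2 / δ) / ε ^ 2) ≤ T →
          (1 - δ) ^ 2 ≤
            (SingleAncilla.singleAncillaLCU hO P.coeff (P.unitary H)
              (SingleAncilla.pureState b) T).real
              {out : ℝ × ℝ | 0 < out.2 ∧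
                |out.1 / out.2 -
                  SingleAncilla.expectation O (SingleAncilla.solutionState hH b)| ≤ ε}) ∧
        P.maxRunTime ≤ C * (κ * Real.log (2 * ‖O‖ * κ / ε))) := by
  refine ⟨?_, fun A hA => ?_⟩
  · obtain ⟨A, hA, h⟩ := SingleAncilla.FourierParams.exists_isTheta_norm_inv_sub_g_le
    refine ⟨A, hA, fun κ γ hκ hγ0 hγ => ?_⟩
    obtain ⟨P, hP, hg⟩ := h κ γ hκ hγ0 hγ
    exact ⟨P, hP, hg, fun N H hH hspec => P.norm_hermInv_sub_gMat_le hH hγ0.le hspec hg⟩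
  -- Here 648 = 2 · 18² comes from Hoeffding with 1/γ² = 18²‖O‖²/ε², 20736 A¹² from ‖c‖₁⁴, and 25
  -- from squaring log(κ/γ) ≤ 5l. The evolution time needs only 10 A⁴.
  refine ⟨648 * 20736 * 25 * A ^ 12, by positivity, ?_⟩
  intro N H hH O hO b κ ε δ γ P hκ hspec hb hrange hε hε1 hδ hδ1 hεO hγ hP happrox
  have hO0 : 0 < ‖O‖ := hε.trans_le hεO
  have hκ0 : 0 < κ := by linarith
  have hγ0 : 0 < γ := by rw [hγ]; positivity
  have hγ18 : γ ≤ 1 / 18 := by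
    rw [hγ, div_le_div_iff₀ (by positivity) (by norm_num)]
    linarith
  have hεγ : ‖O‖ * γ = ε / 18 := by rw [hγ]; field_simp
  have hx1 : 1 ≤ ‖O‖ * κ / ε := by
    rw [le_div_iff₀ hε]; nlinarith
  have hκγ : κ / γ = 18 * (‖O‖ * κ / ε) := by rw [hγ]; field_simp
  have h2x : 2 * ‖O‖ * κ / ε = 2 * (‖O‖ * κ / ε) := by ring
  rw [h2x]
  set l := Real.log (2 * (‖O‖ * κ / ε)) with hl
  have hl0 : 0 < l := Real.log_pos (by linarith)
  have hL1 : 1 ≤ Real.log (κ / γ) := by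
    rw [hκγ]; exact SingleAncilla.one_le_log_eighteen_mul hx1
  have hLl : Real.log (κ / γ) ≤ 5 * l := by
    rw [hκγ]; exact SingleAncilla.log_eighteen_mul_le hx1
  have hL0 : 0 < Real.log (κ / γ) := by linarith
  have hy := hP.Δy_pos hA hγ0 hL0
  have hz := hP.Δz_pos hA hκ0 hL0
  have hlogδ : 0 < Real.log (2 / δ) := Real.log_pos (by rw [lt_div_iff₀ hδ]; linarith)
  refine ⟨fun T hT => ?_, ?_⟩
  · have hT0 : 0 < T := by
      have : (0 : ℝ) < T := lt_of_lt_of_le (by positivity) hT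
      exact_mod_cast this
    refine SingleAncilla.one_sub_sq_le_singleAncillaLCU hH hO hκ hspec hb hrange hε hδ hδ1 hO0 hγ0
      hγ18 hεγ hy.le hz.le happrox hT0 (le_trans ?_ hT)
    calc 2 * (∑ p, P.coeff p) ^ 4 / γ ^ 2 * Real.log (2 / δ)
        ≤ 2 * (20736 * A ^ 12 * κ ^ 4 * (5 * l) ^ 2) / γ ^ 2 * Real.log (2 / δ) := by
          gcongr
          refine (hP.sum_coeff_pow_four_le hA hκ hγ0 hL1).trans ?_
          gcongr
      _ = _ := by rw [hγ]; field_simp; ring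
  · refine (SingleAncilla.FourierParams.maxRunTime_le hy hz).trans ?_
    calc 2 * ((P.J * P.Δy) * (P.K * P.Δz))
        ≤ 2 * ((A ^ 2 * (κ * √(Real.log (κ / γ)))) * (A ^ 2 * √(Real.log (κ / γ)))) := by
          refine mul_le_mul_of_nonneg_left (mul_le_mul (hP.J_mul_Δy_le hA hκ0 hγ0 hL0)
            (hP.K_mul_Δz_le hA hκ0 hL0) ?_ ?_) (by norm_num)
          · positivity
          · positivity
      _ = 2 * A ^ 4 * κ * √(Real.log (κ / γ)) ^ 2 := by ring
      _ = 2 * A ^ 4 * κ * Real.log (κ / γ) := by rw [Real.sq_sqrt hL0.le]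
      _ ≤ 2 * A ^ 12 * κ * (5 * l) := by
          gcongr
          norm_num
      _ = 10 * (A ^ 12 * (κ * l)) := by ring
      _ ≤ 648 * 20736 * 25 * (A ^ 12 * (κ * l)) := by
          gcongr
          norm_num
      _ = _ := by ring
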